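/- Let $J\subset\mathbb R$ be open (for instance an open interval), let $\sigma_1,\sigma_2,\sigma_3$ be the left-invariant one-forms on $SU(2)$ with $d\sigma_1=\sigma_2\wedge\sigma_3$, $d\sigma_2=\sigma_3\wedge\sigma_1$, $d\sigma_3=\sigma_1\wedge\sigma_2$, and let $$g=(abc)^2dt^2+a^2\tilde\sigma_1^2+b^2\tilde\sigma_2^2+c^2\tilde\sigma_3^2,\qquad (\tilde\sigma_1,\tilde\sigma_2,\tilde\sigma_3)^T=R(t)\,(\sigma_1,\sigma_2,\sigma_3)^T,$$ be an $SU(2)$-invariant metric on $M=J\times SU(2)$, where $a,b,c>0$ and $R$ (with values in $SO(3)$) are smooth functions of $t\in J$. Put $w_1=bc$, $w_2=ca$, $w_3=ab$. Define $\alpha_1,\alpha_2,\alpha_3$ by $$\dot w_1=-w_2w_3+w_1(\alpha_2+\alpha_3),\quad \dot w_2=-w_3w_1+w_2(\alpha_3+\alpha_1),\quad \dot w_3=-w_1w_2+w_3(\alpha_1+\alpha_2),$$ define $\xi_1,\xi_2,\xi_3$ by $$\dot RR^{-1}=\begin{pmatrix}0&\xi_3&-\xi_2\\-\xi_3&0&\xi_1\\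 \xi_2&-\xi_1&0\end{pmatrix},$$ and put $$X_1=\frac{w_2^2-w_3^2}{w_2w_3}\,\xi_1,\qquad X_2=\frac{w_3^2-w_1^2}{w_3w_1}\,\xi_2,\qquad X_3=\frac{w_1^2-w_2^2}{w_1w_2}\,\xi_3 .$$ Orient $M$ so that $-dt\wedge\tilde\sigma_1\wedge\tilde\sigma_2\wedge\tilde\sigma_3$ is positive; thus, with $e^0=abc\,dt$, $e^1=a\tilde\sigma_1$, $e^2=b\tilde\sigma_2$, $e^3=c\tilde\sigma_3$, the self-dual two-forms are spanned by $e^0\wedge e^1-e^2\wedge e^3$, $e^0\wedge e^2-e^3\wedge e^1$ and $e^0\wedge e^3-e^1\wedge e^2$. Suppose that $g$ is anti-self-dual ($W^+=0$) with vanishing scalar curvature, and let $(g,I)$ be an $SU(2)$-invariant Hermitian structure on $M$ compatible with the orientation: $I$ is a smooth $SU(2)$-invariant integrable $g$-orthogonal almost complex structure whose Kähler form $\Omega=g(I\cdot,\cdot)$ is self-dual. Then $(g,I)$ is Kähler, that is, $d\Omega=0$ on $M$, if and only if $$X_1^2=4\alpha_2\alpha_3,\qquad X_2^2=4\alpha_3\alpha_1,\qquad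 X_3^2=4\alpha_1\alpha_2\qquad\text{on } J.$$ Moreover, if $f$ is a continuous function on $J$ with $$X_1^2=4(f-\alpha_2)(f-\alpha_3),\qquad X_2^2=4(f-\alpha_3)(f-\alpha_1),\qquad X_3^2=4(f-\alpha_1)(f-\alpha_2)\qquad\text{on } J,$$ then $(g,I)$ is Kähler if and only if $f=0$ on $J$. -/

import Mathlib

open scoped Quaternion ContDiff

noncomputable section

namespace SU2Metric

/-! ## The manifold `J × SU(2)` and its left-invariant coframe

`SU(2)` is the group of unit quaternions, and `J × SU(2)` is identified with an open subset of
`ℍ` through the diffeomorphism `(t, u) ↦ exp t • u`.  The group `SU(2)` acts by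
left multiplication. -/

/-- The coordinate `t` on `ℍ ∖ {0} ≅ ℝ × SU(2)`. -/
def time (q : ℍ) : ℝ := Real.log ‖q‖

/-- The open subset of `ℍ` that corresponds to `J × SU(2)`. -/
def cylinder (J : Set ℝ) : Set ℍ := {q | q ≠ 0 ∧ time q ∈ J}

/-- The one-form `dt`. -/
def dt (q : ℍ) : ℍ →L[ℝ] ℝ := fderiv ℝ time q

/-- The three imaginary units. -/
def imUnit (i : Fin 3) : ℍ :=
  ⟨0, if i = 0 then 1 else 0, if i = 1 then 1 else 0, if i = 2 then 1 else 0⟩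

/-- The three imaginary components of a quaternion, that is, its Euclidean inner products with
the imaginary units. -/
def imComp (i : Fin 3) : ℍ →L[ℝ] ℝ := innerSL ℝ (imUnit i)

theorem imComp_apply (i : Fin 3) (q : ℍ) : imComp i q = ![q.imI, q.imJ, q.imK] i := by
  rw [imComp, innerSL_apply_apply, Quaternion.inner_def, Quaternion.re_mul]
  fin_cases i <;> simp [imUnit]

theorem imComp_imUnit (i l : Fin 3) : imComp i (imUnit l) = if i = l then 1 else 0 := by
  rw [imComp_apply]
  fin_cases i <;> fin_cases l <;> simp [imUnit]

/-- The left-invariant one-forms `σ₁, σ₂, σ₃` on `SU(2)` (pulled back to `J × SU(2)`): the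
imaginary components of `-2 q⁻¹ dq`.  They satisfy `dσ₁ = σ₂ ∧ σ₃`, `dσ₂ = σ₃ ∧ σ₁` and
`dσ₃ = σ₁ ∧ σ₂`. -/
def sigma (i : Fin 3) (q : ℍ) : ℍ →L[ℝ] ℝ :=
  (-2 : ℝ) • (imComp i).comp (ContinuousLinearMap.mul ℝ ℍ q⁻¹)

/-- The exterior derivative of a one-form, evaluated on two vectors. -/
def dOne (η : ℍ → ℍ →L[ℝ] ℝ) (q v w : ℍ) : ℝ :=
  extDeriv (fun x => ContinuousAlternatingMap.ofSubsingleton ℝ ℍ ℝ (0 : Fin 1) (η x)) q ![v, w]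

/-- The wedge product of two one-forms at a point, evaluated on two vectors. -/
def wedge (η θ : ℍ →L[ℝ] ℝ) (v w : ℍ) : ℝ := η v * θ w - η w * θ v

/-! ## Invariant metrics -/

/-- The functions that determine an `SU(2)`-invariant metric
`(a b c)² dt² + a² σ̃₁² + b² σ̃₂² + c² σ̃₃²` on `J × SU(2)`, where `σ̃ = R(t) σ` with `R`
valued in `SO(3)`.  The functions `a, b, c` are `a 0, a 1, a 2`. -/
structure InvariantMetric (J : Set ℝ) where
  a : Fin 3 → ℝ → ℝ
  R : ℝ → Matrix (Fin 3) (Fin 3) ℝ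
  a_smooth : ∀ i, ContDiffOn ℝ ∞ (a i) J
  a_pos : ∀ i, ∀ t ∈ J, 0 < a i t
  R_smooth : ∀ i j, ContDiffOn ℝ ∞ (fun t => R t i j) J
  R_mem : ∀ t ∈ J, R t ∈ Matrix.specialOrthogonalGroup (Fin 3) ℝ

namespace InvariantMetric

variable {J : Set ℝ} (D : InvariantMetric J)

/-- The product `a b c`. -/
def vol (t : ℝ) : ℝ := D.a 0 t * D.a 1 t * D.a 2 t

/-- The rotated one-forms `σ̃ = R(t) σ`. -/
def sigmaTilde (i : Fin 3) (q : ℍ) : ℍ →L[ℝ] ℝ := ∑ l, D.R (time q) i l • sigma l q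

/-- The metric `g = (a b c)² dt² + a² σ̃₁² + b² σ̃₂² + c² σ̃₃²`. -/
def metric (q : ℍ) : ℍ →L[ℝ] ℍ →L[ℝ] ℝ :=
  (D.vol (time q)) ^ 2 • (dt q).smulRight (dt q) +
    ∑ i, (D.a i (time q)) ^ 2 • (D.sigmaTilde i q).smulRight (D.sigmaTilde i q)

/-- The orthonormal coframe `e⁰ = a b c dt`, `e¹ = a σ̃₁`, `e² = b σ̃₂`, `e³ = c σ̃₃`. -/
def coframe : Fin 4 → ℍ → ℍ →L[ℝ] ℝ :=
  Fin.cons (fun q => D.vol (time q) • dt q) (fun i q => D.a i (time q) • D.sigmaTilde i q)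

/-- The orthonormal frame dual to `coframe`. -/
def frame : Fin 4 → ℍ → ℍ :=
  Fin.cons (fun q => (D.vol (time q))⁻¹ • q)
    (fun i q => (D.a i (time q))⁻¹ • ∑ l, D.R (time q) i l • (q * ((-1 / 2 : ℝ) • imUnit l)))

/-! ### The functions `w`, `α`, `ξ`, `X` of `t` -/

/-- `w₁ = b c`, `w₂ = c a`, `w₃ = a b`. -/
def w (i : Fin 3) (t : ℝ) : ℝ := D.a (i + 1) t * D.a (i + 2) t

/-- The sum `αⱼ + αₖ`, where `(i, j, k)` is cyclic, read off from
`ẇᵢ = -wⱼ wₖ + wᵢ (αⱼ + αₖ)`. -/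
def alphaSum (i : Fin 3) (t : ℝ) : ℝ :=
  (deriv (D.w i) t + D.w (i + 1) t * D.w (i + 2) t) / D.w i t

/-- The functions `α₁, α₂, α₃`, that is, the solution of
`ẇ₁ = -w₂ w₃ + w₁ (α₂ + α₃)`, `ẇ₂ = -w₃ w₁ + w₂ (α₃ + α₁)`, `ẇ₃ = -w₁ w₂ + w₃ (α₁ + α₂)`
(see `deriv_w`). -/
def alpha (i : Fin 3) (t : ℝ) : ℝ :=
  (D.alphaSum (i + 1) t + D.alphaSum (i + 2) t - D.alphaSum i t) / 2

/-- The functions `ξ₁, ξ₂, ξ₃`: the entries `(2,3)`, `(3,1)`, `(1,2)` of the skew matrix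
`Ṙ R⁻¹ = Ṙ Rᵀ`, which is therefore `!![0, ξ₃, -ξ₂; -ξ₃, 0, ξ₁; ξ₂, -ξ₁, 0]`. -/
def xi (i : Fin 3) (t : ℝ) : ℝ :=
  ∑ l, deriv (fun s => D.R s (i + 1) l) t * D.R t (i + 2) l

/-- `X₁ = (w₂² - w₃²) / (w₂ w₃) ξ₁` and cyclically. -/
def X (i : Fin 3) (t : ℝ) : ℝ :=
  ((D.w (i + 1) t) ^ 2 - (D.w (i + 2) t) ^ 2) / (D.w (i + 1) t * D.w (i + 2) t) * D.xi i t

theorem deriv_w {t : ℝ} (ht : t ∈ J) (i : Fin 3) :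
    deriv (D.w i) t = -(D.w (i + 1) t * D.w (i + 2) t) +
      D.w i t * (D.alpha (i + 1) t + D.alpha (i + 2) t) := by
  have h : D.w i t ≠ 0 := (mul_pos (D.a_pos _ t ht) (D.a_pos _ t ht)).ne'
  have e : D.alpha (i + 1) t + D.alpha (i + 2) t = D.alphaSum i t := by
    fin_cases i <;> simp [alpha, Fin.reduceAdd] <;> ring
  rw [e, alphaSum]
  field_simp
  ring

/-! ### Curvature

The orientation is the one for which `-dt ∧ σ̃₁ ∧ σ̃₂ ∧ σ̃₃` is positive, so that the self-dual
two-forms are spanned by `e⁰ ∧ e¹ - e² ∧ e³`, `e⁰ ∧ e² - e³ ∧ e¹`, `e⁰ ∧ e³ - e¹ ∧ e²`. -/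

/-- `conn i j` are the Levi-Civita connection forms `ωⁱⱼ` of the orthonormal coframe:
`ωⁱⱼ + ωʲᵢ = 0` and `deⁱ + ∑ⱼ ωⁱⱼ ∧ eʲ = 0`. -/
structure IsConnectionForm (conn : Fin 4 → Fin 4 → ℍ → ℍ →L[ℝ] ℝ) : Prop where
  smooth : ∀ i j, ContDiffOn ℝ ∞ (conn i j) (cylinder J)
  skew : ∀ i j, ∀ q ∈ cylinder J, conn i j q + conn j i q = 0
  torsion_free : ∀ i, ∀ q ∈ cylinder J, ∀ v w : ℍ,
    dOne (D.coframe i) q v w + ∑ j, wedge (conn i j q) (D.coframe j q) v w = 0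

/-- The components `Rⁱⱼₖₗ` in the orthonormal frame of the curvature forms
`dωⁱⱼ + ∑ₘ ωⁱₘ ∧ ωᵐⱼ`. -/
def curv (conn : Fin 4 → Fin 4 → ℍ → ℍ →L[ℝ] ℝ) (q : ℍ) (i j k l : Fin 4) : ℝ :=
  dOne (conn i j) q (D.frame k q) (D.frame l q) +
    ∑ m, wedge (conn i m q) (conn m j q) (D.frame k q) (D.frame l q)

/-- The scalar curvature. -/
def scalarCurv (conn : Fin 4 → Fin 4 → ℍ → ℍ →L[ℝ] ℝ) (q : ℍ) : ℝ :=
  ∑ i, ∑ j, D.curv conn q i j i j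

/-- The block of the curvature operator that maps self-dual two-forms to self-dual two-forms, in
the orthonormal basis `(e⁰ ∧ eⁱ - eʲ ∧ eᵏ) / √2`, `(i, j, k)` cyclic. -/
def blockA (conn : Fin 4 → Fin 4 → ℍ → ℍ →L[ℝ] ℝ) (q : ℍ) : Matrix (Fin 3) (Fin 3) ℝ :=
  Matrix.of fun r s =>
    (D.curv conn q 0 r.succ 0 s.succ - D.curv conn q 0 r.succ (s + 1).succ (s + 2).succ
      - D.curv conn q (r + 1).succ (r + 2).succ 0 s.succ
      + D.curv conn q (r + 1).succ (r + 2).succ (s + 1).succ (s + 2).succ) / 2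

/-- The self-dual part of the Weyl tensor. -/
def weylPlus (conn : Fin 4 → Fin 4 → ℍ → ℍ →L[ℝ] ℝ) (q : ℍ) : Matrix (Fin 3) (Fin 3) ℝ :=
  D.blockA conn q - (D.scalarCurv conn q / 12) • (1 : Matrix (Fin 3) (Fin 3) ℝ)

/-- The metric is anti-self-dual (the self-dual part of its Weyl tensor vanishes) and has vanishing
scalar curvature.  The connection forms are unique on `cylinder J`. -/
def IsASDScalarFlat : Prop :=
  ∃ conn, D.IsConnectionForm conn ∧
    ∀ q ∈ cylinder J, D.weylPlus conn q = 0 ∧ D.scalarCurv conn q = 0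

/-! ### Hermitian structures -/

/-- The Kähler form `Ω(v, w) = g(I v, w)` of an almost complex structure `I`, written as a
differential form by skew-symmetrizing (see `kahlerForm_apply`). -/
def kahlerForm (I : ℍ → ℍ →L[ℝ] ℍ) (q : ℍ) : ℍ [⋀^Fin 2]→L[ℝ] ℝ :=
  (1 / 2 : ℝ) • ContinuousAlternatingMap.alternatizeUncurryFin
    ((ContinuousAlternatingMap.ofSubsingletonLIE (𝕜 := ℝ) (E := ℍ) (F := ℝ)
        (0 : Fin 1)).toContinuousLinearEquiv.toContinuousLinearMap.comp
      ((D.metric q).comp (I q)))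

/-- A Hermitian structure: `I` is a smooth `g`-orthogonal almost complex structure whose Nijenhuis
tensor vanishes. -/
structure IsHermitian (I : ℍ → ℍ →L[ℝ] ℍ) : Prop where
  smooth : ContDiffOn ℝ ∞ I (cylinder J)
  sq_eq_neg : ∀ q ∈ cylinder J, ∀ v, I q (I q v) = -v
  orthogonal : ∀ q ∈ cylinder J, ∀ v w, D.metric q (I q v) (I q w) = D.metric q v w
  integrable : ∀ V W : ℍ → ℍ, ContDiffOn ℝ ∞ V (cylinder J) → ContDiffOn ℝ ∞ W (cylinder J) →
    ∀ q ∈ cylinder J,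
      VectorField.lieBracket ℝ (fun x => I x (V x)) (fun x => I x (W x)) q
        - I q (VectorField.lieBracket ℝ (fun x => I x (V x)) W q)
        - I q (VectorField.lieBracket ℝ V (fun x => I x (W x)) q)
        - VectorField.lieBracket ℝ V W q = 0

/-- `I` is compatible with the orientation: its Kähler form is self-dual. -/
def IsOriented (I : ℍ → ℍ →L[ℝ] ℍ) : Prop :=
  ∀ q ∈ cylinder J, ∀ i : Fin 3,
    D.kahlerForm I q ![D.frame 0 q, D.frame i.succ q] =
      -D.kahlerForm I q ![D.frame (i + 1).succ q, D.frame (i + 2).succ q]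

/-- The Kähler condition for a Hermitian structure `I`: the Kähler form is closed. -/
def IsKahler (I : ℍ → ℍ →L[ℝ] ℍ) : Prop :=
  D.IsHermitian I ∧ ∀ q ∈ cylinder J, extDeriv (D.kahlerForm I) q = 0

theorem metric_symm (q v w : ℍ) : D.metric q v w = D.metric q w v := by
  simp [metric, mul_comm]

theorem kahlerForm_apply {I : ℍ → ℍ →L[ℝ] ℍ} (hI : D.IsHermitian I) {q : ℍ}
    (hq : q ∈ cylinder J) (v w : ℍ) : D.kahlerForm I q ![v, w] = D.metric q (I q v) w := by
  have h1 : D.metric q (I q w) v = -D.metric q (I q v) w := by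
    rw [← hI.orthogonal q hq (I q w) v, hI.sq_eq_neg q hq w, map_neg,
      neg_apply, D.metric_symm]
  have h2 : D.kahlerForm I q ![v, w]
      = (1 / 2) * (D.metric q (I q v) w - D.metric q (I q w) v) := by
    simp [kahlerForm, ContinuousAlternatingMap.alternatizeUncurryFin_apply, Fin.sum_univ_two,
      Fin.removeNth]
    ring
  rw [h2, h1]
  ring

end InvariantMetric

/-- `I` is invariant under the action of `SU(2)` by left multiplication. -/
def IsInvariant (J : Set ℝ) (I : ℍ → ℍ →L[ℝ] ℍ) : Prop :=
  ∀ p : ℍ, ‖p‖ = 1 → ∀ q ∈ cylinder J, ∀ v, I (p * q) (p * v) = p * I q v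

end SU2Metric

end

noncomputable section

namespace SU2Metric

/-! On the frame formed by the radial field and three rotated left-invariant fields, all rescaled to
length `abc`, every invariant object has components depending on `t` alone, so the theorem becomes a
statement about functions of `t`. The Levi-Civita connection induces an `SO(3)`-connection on the
bundle of self-dual forms. Its components along `SU(2)` are, up to sign, a symmetric matrix `S`
(`shape`) with diagonal entries `αᵢ` and off-diagonal entries `-Xᵢ/2`; its radial component is a
rotation vector (`rot`). An oriented invariant `I` is a unit vector `x(t)` (`dir`).

Write `T = tr S`, `ζ = x·Sx`, and `e₂` for the second invariant of `S`. Three computations carry the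
proof. Integrability gives `x' = x × rot - Sx + ζx` (`deriv_dir`) and forces the compression of `S`
to the complement of `x` to be the scalar `(T - ζ)/2` (`shape_eq`). Closedness of `Ω` amounts to
`2Sx = (T + ζ)x` (`closed_iff`); pairing with `x` gives `T = ζ`, and with `shape_eq` this yields `S
= ζxxᵀ`. Vanishing of the self-dual curvature block gives `S' = e₂ - 2 adj S + [K, S]` with `K` skew
(`deriv_shape`), hence `e₂' = 6 det S` (`deriv_shapeMinors`).

If `S = ζxxᵀ`, its principal `2 × 2` minors vanish, and these are exactly the equations `Xᵢ² =
4αⱼαₖ`. Conversely those equations give `e₂ = 0` on `J`, so `det S = 0` as well, and linear algebra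
returns `S = ζxxᵀ` (`eigenvector_of_invariants_eq_zero`).

For the second criterion, `f = 0` reduces to the first. If `Ω` is closed but `f ≠ 0` at a point,
then `xᵢ² = 1/3` near it, so `x' = 0` and `rot` is parallel to `x`; the relations between `rot` and
`S` (`rot_mul_sub`) then add up to a contradiction with `wᵢ > 0`. -/

/-! ### Calculus of the time coordinate and of left-invariant fields -/

theorem contDiffAt_time {q : ℍ} (hq : q ≠ 0) : ContDiffAt ℝ ∞ time q :=
  (contDiffAt_norm ℝ hq).log (norm_ne_zero_iff.2 hq)

theorem differentiableAt_time {q : ℍ} (hq : q ≠ 0) : DifferentiableAt ℝ time q :=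
  (contDiffAt_time hq).differentiableAt (by simp)

theorem hasFDerivAt_time {q : ℍ} (hq : q ≠ 0) : HasFDerivAt time (dt q) q :=
  (differentiableAt_time hq).hasFDerivAt

/-- Writing `time` as half the logarithm of `‖x‖²`, this follows from `⟪q, qv⟫ = ‖q‖² Re v`. -/
theorem dt_mul {q : ℍ} (hq : q ≠ 0) (v : ℍ) : dt q (q * v) = v.re := by
  have hn : ‖q‖ ≠ 0 := norm_ne_zero_iff.2 hq
  have h1 : HasFDerivAt (fun x : ℍ => ‖x‖ ^ 2) (2 • innerSL ℝ q) q :=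
    (hasStrictFDerivAt_norm_sq q).hasFDerivAt
  have h2 := (h1.log (pow_ne_zero 2 hn)).const_mul (1 / 2)
  have h3 : (fun x : ℍ => 1 / 2 * Real.log (‖x‖ ^ 2)) = time := by
    ext x; rw [Real.log_pow, time]; push_cast; ring
  rw [h3] at h2
  rw [dt, h2.fderiv]
  have h4 : inner ℝ q (q * v) = ‖q‖ ^ 2 * v.re := by
    rw [Quaternion.inner_def, ← real_inner_self_eq_norm_sq, Quaternion.inner_def]
    simp [Quaternion.re_mul]; ring
  simp only [smul_apply, innerSL_apply_apply, h4, smul_eq_mul, nsmul_eq_mul]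
  push_cast
  field_simp

theorem fderiv_comp_time {φ : ℝ → ℝ} {q : ℍ} (hq : q ≠ 0) (hφ : DifferentiableAt ℝ φ (time q))
    (v : ℍ) : fderiv ℝ (fun x => φ (time x)) q (q * v) = v.re * deriv φ (time q) := by
  have := hφ.hasDerivAt.comp_hasFDerivAt q (hasFDerivAt_time hq)
  rw [show (fun x => φ (time x)) = φ ∘ time from rfl, this.fderiv]
  simp [dt_mul hq, mul_comm]

/-- The vector field `x ↦ x * v (time x)`, which is invariant under left multiplication by unit
quaternions. -/
def leftField (v : ℝ → ℍ) (x : ℍ) : ℍ := x * v (time x)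

theorem hasFDerivAt_leftField {v : ℝ → ℍ} {q : ℍ} (hq : q ≠ 0)
    (hv : DifferentiableAt ℝ v (time q)) :
    HasFDerivAt (leftField v)
      ((ContinuousLinearMap.mul ℝ ℍ q).comp ((dt q).smulRight (deriv v (time q))) +
        (ContinuousLinearMap.mul ℝ ℍ).flip (v (time q))) q := by
  have h := hv.hasDerivAt.hasFDerivAt.comp q (hasFDerivAt_time hq)
  refine ((hasFDerivAt_id q).mul' h).congr_fderiv ?_
  ext x <;> simp

theorem differentiableAt_leftField {v : ℝ → ℍ} {q : ℍ} (hq : q ≠ 0)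
    (hv : DifferentiableAt ℝ v (time q)) : DifferentiableAt ℝ (leftField v) q :=
  (hasFDerivAt_leftField hq hv).differentiableAt

theorem contDiffOn_leftField {v : ℝ → ℍ} {J : Set ℝ} (hv : ContDiffOn ℝ ∞ v J) :
    ContDiffOn ℝ ∞ (leftField v) (cylinder J) := by
  have h : ContDiffOn ℝ ∞ time (cylinder J) := fun q hq =>
    (contDiffAt_time hq.1).contDiffWithinAt
  exact contDiffOn_id.mul (hv.comp h fun q hq => hq.2)

theorem isOpen_cylinder {J : Set ℝ} (hJ : IsOpen J) : IsOpen (cylinder J) := by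
  have h : ContinuousOn time {q : ℍ | q ≠ 0} := fun q hq =>
    (differentiableAt_time hq).continuousAt.continuousWithinAt
  exact h.isOpen_inter_preimage isOpen_ne hJ

/-- The bracket of left-invariant vector fields with coefficients depending on time. -/
def leftBracket (v w : ℝ → ℍ) (t : ℝ) : ℍ :=
  v t * w t - w t * v t + (v t).re • deriv w t - (w t).re • deriv v t

/-- The derivative of `x * w(t)` in the direction `q * v` is `q * (v w + Re v • w')`;
antisymmetrizing gives the bracket. -/
theorem lieBracket_leftField {v w : ℝ → ℍ} {q : ℍ} (hq : q ≠ 0)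
    (hv : DifferentiableAt ℝ v (time q)) (hw : DifferentiableAt ℝ w (time q)) :
    VectorField.lieBracket ℝ (leftField v) (leftField w) q = leftField (leftBracket v w) q := by
  rw [VectorField.lieBracket, (hasFDerivAt_leftField hq hv).fderiv,
    (hasFDerivAt_leftField hq hw).fderiv]
  simp only [leftField, leftBracket, add_apply, ContinuousLinearMap.comp_apply,
    ContinuousLinearMap.smulRight_apply, ContinuousLinearMap.mul_apply', dt_mul hq,
    ContinuousLinearMap.flip_apply, mul_add, mul_sub, mul_assoc]
  abel

theorem dOne_apply {η : ℍ → ℍ →L[ℝ] ℝ} {q : ℍ} (hη : DifferentiableAt ℝ η q) (v w : ℍ) :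
    dOne η q v w = fderiv ℝ η q v w - fderiv ℝ η q w v := by
  set L := (ContinuousAlternatingMap.ofSubsingletonLIE (𝕜 := ℝ) (E := ℍ) (F := ℝ)
        (0 : Fin 1)).toContinuousLinearEquiv with hL
  have h1 : HasFDerivAt (fun x => L (η x)) _ q :=
    L.toContinuousLinearMap.hasFDerivAt.comp q hη.hasFDerivAt
  change extDeriv (fun x => L (η x)) q ![v, w] = _
  rw [extDeriv, h1.fderiv]
  simp [ContinuousAlternatingMap.alternatizeUncurryFin_apply, Fin.sum_univ_two, hL, Fin.removeNth,
    sub_eq_add_neg]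

theorem hasFDerivAt_sub_clm {E : Type*} [NormedAddCommGroup E] [NormedSpace ℝ E]
    {η θ : E → E →L[ℝ] ℝ} {q : E} (hη : DifferentiableAt ℝ η q) (hθ : DifferentiableAt ℝ θ q) :
    HasFDerivAt (fun x => η x - θ x) (fderiv ℝ η q - fderiv ℝ θ q) q :=
  hη.hasFDerivAt.sub hθ.hasFDerivAt

theorem dOne_sub {η θ : ℍ → ℍ →L[ℝ] ℝ} {q : ℍ} (hη : DifferentiableAt ℝ η q)
    (hθ : DifferentiableAt ℝ θ q) (v w : ℍ) :
    dOne (fun x => η x - θ x) q v w = dOne η q v w - dOne θ q v w := by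
  have h := hasFDerivAt_sub_clm hη hθ
  rw [dOne_apply h.differentiableAt, dOne_apply hη, dOne_apply hθ, h.fderiv]
  simp only [sub_apply]
  ring

/-- Cartan's formula for a one-form whose values on two left-invariant fields depend on time
only. -/
theorem dOne_leftField {η : ℍ → ℍ →L[ℝ] ℝ} {v w : ℝ → ℍ} {φ ψ : ℝ → ℝ} {q : ℍ} (hq : q ≠ 0)
    (hη : DifferentiableAt ℝ η q)
    (hv : DifferentiableAt ℝ v (time q)) (hw : DifferentiableAt ℝ w (time q))
    (hφ : DifferentiableAt ℝ φ (time q)) (hψ : DifferentiableAt ℝ ψ (time q))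
    (h1 : ∀ᶠ x in nhds q, η x (leftField v x) = φ (time x))
    (h2 : ∀ᶠ x in nhds q, η x (leftField w x) = ψ (time x)) :
    dOne η q (leftField v q) (leftField w q) =
      (v (time q)).re * deriv ψ (time q) - (w (time q)).re * deriv φ (time q)
        - η q (leftField (leftBracket v w) q) := by
  have f1 : fderiv ℝ (fun x => η x (leftField v x)) q (leftField w q) =
      (w (time q)).re * deriv φ (time q) := by
    rw [Filter.EventuallyEq.fderiv_eq h1, leftField, fderiv_comp_time hq hφ]
  have f2 : fderiv ℝ (fun x => η x (leftField w x)) q (leftField v q) =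
      (v (time q)).re * deriv ψ (time q) := by
    rw [Filter.EventuallyEq.fderiv_eq h2, leftField, fderiv_comp_time hq hψ]
  rw [← lieBracket_leftField hq hv hw, ← f1, ← f2, dOne_apply hη, VectorField.lieBracket,
    fderiv_clm_apply hη (differentiableAt_leftField hq hv),
    fderiv_clm_apply hη (differentiableAt_leftField hq hw)]
  simp
  ring

/-- Cartan's formula for a two-form whose values on three left-invariant fields depend on time
only. -/
theorem extDeriv_leftField {Ω : ℍ → ℍ [⋀^Fin 2]→L[ℝ] ℝ} {v : Fin 3 → ℝ → ℍ}
    {φ : Fin 3 → ℝ → ℝ} {q : ℍ} (hq : q ≠ 0) (hΩ : DifferentiableAt ℝ Ω q)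
    (hv : ∀ i, DifferentiableAt ℝ (v i) (time q)) (hφ : ∀ i, DifferentiableAt ℝ (φ i) (time q))
    (h0 : ∀ᶠ x in nhds q, Ω x ![leftField (v 1) x, leftField (v 2) x] = φ 0 (time x))
    (h1 : ∀ᶠ x in nhds q, Ω x ![leftField (v 2) x, leftField (v 0) x] = φ 1 (time x))
    (h2 : ∀ᶠ x in nhds q, Ω x ![leftField (v 0) x, leftField (v 1) x] = φ 2 (time x)) :
    extDeriv Ω q (fun i => leftField (v i) q) =
      (∑ i, (v i (time q)).re * deriv (φ i) (time q))
        - Ω q ![leftField (leftBracket (v 0) (v 1)) q, leftField (v 2) q]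
        - Ω q ![leftField (leftBracket (v 1) (v 2)) q, leftField (v 0) q]
        - Ω q ![leftField (leftBracket (v 2) (v 0)) q, leftField (v 1) q] := by
  have swap : ∀ x a b, Ω x ![a, b] = -Ω x ![b, a] := by
    intro x a b
    have := (Ω x).map_swap ![b, a] (i := 0) (j := 1) (by decide)
    refine Eq.trans ?_ this
    change Ω x _ = Ω x _
    congr 1; funext i; fin_cases i <;> rfl
  rw [extDeriv_apply_vectorField (V := fun i => leftField (v i)) hΩ
    fun i => differentiableAt_leftField hq (hv i)]
  have r0 : ∀ x, (0 : Fin 3).removeNth (fun i => leftField (v i) x)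
      = ![leftField (v 1) x, leftField (v 2) x] := by
    intro x; funext i; fin_cases i <;> rfl
  have r1 : ∀ x, (1 : Fin 3).removeNth (fun i => leftField (v i) x)
      = ![leftField (v 0) x, leftField (v 2) x] := by
    intro x; funext i; fin_cases i <;> rfl
  have r2 : ∀ x, (2 : Fin 3).removeNth (fun i => leftField (v i) x)
      = ![leftField (v 0) x, leftField (v 1) x] := by
    intro x; funext i; fin_cases i <;> rfl
  have D0 : fderiv ℝ (fun x => Ω x ![leftField (v 1) x, leftField (v 2) x]) q (leftField (v 0) q)
      = (v 0 (time q)).re * deriv (φ 0) (time q) := by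
    rw [Filter.EventuallyEq.fderiv_eq h0, leftField, fderiv_comp_time hq (hφ 0)]
  have D1 : fderiv ℝ (fun x => Ω x ![leftField (v 0) x, leftField (v 2) x]) q (leftField (v 1) q)
      = -((v 1 (time q)).re * deriv (φ 1) (time q)) := by
    -- The alternating sign of the middle term is absorbed by stating `h1` for the cyclic order `(2,
    -- 0)`.
    have h1' : (fun x => Ω x ![leftField (v 0) x, leftField (v 2) x]) =ᶠ[nhds q]
        fun x => -φ 1 (time x) := by
      filter_upwards [h1] with x hx
      rw [swap, hx]
    rw [h1'.fderiv_eq, fderiv_fun_neg, neg_apply, leftField, fderiv_comp_time hq (hφ 1)]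
  have D2 : fderiv ℝ (fun x => Ω x ![leftField (v 0) x, leftField (v 1) x]) q (leftField (v 2) q)
      = (v 2 (time q)).re * deriv (φ 2) (time q) := by
    rw [Filter.EventuallyEq.fderiv_eq h2, leftField, fderiv_comp_time hq (hφ 2)]
  have i0 : Finset.Ici (0 : Fin 2) = {0, 1} := by decide
  have i1 : Finset.Ici (1 : Fin 2) = {1} := by decide
  rw [Fin.sum_univ_three, Fin.sum_univ_two, Fin.sum_univ_three, i0, i1]
  simp only [r0, r1, r2, D0, D1, D2]
  rw [Finset.sum_pair (by decide), Finset.sum_singleton]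
  simp only [lieBracket_leftField hq (hv _) (hv _)]
  have b : ∀ (i j : Fin 2) (k : Fin 3) (z : ℍ), (i.castSucc).succAbove (j.succAbove 0) = k →
      Matrix.vecCons z (j.removeNth (i.castSucc.removeNth fun x => leftField (v x) q)) =
        ![z, leftField (v k) q] := by
    intro i j k z h
    subst h
    funext m; fin_cases m <;> rfl
  rw [b 0 0 2 _ (by decide), b 0 1 1 _ (by decide), b 1 1 0 _ (by decide)]
  have c : leftField (leftBracket (v 2) (v 0)) q = -leftField (leftBracket (v 0) (v 2)) q := by
    simp only [leftField, leftBracket, ← mul_neg]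
    congr 1; abel
  have n : ∀ a c, Ω q ![-a, c] = -Ω q ![a, c] := by
    intro a c
    have := (Ω q).map_update_smul ![a, c] 0 (-1) a
    have u : ∀ y, Function.update ![a, c] 0 y = ![y, c] := by
      intro y; funext m; fin_cases m <;> rfl
    rw [u, u] at this
    simpa using this
  rw [c, n]
  simp
  ring

@[simp] theorem imUnit_re (i : Fin 3) : (imUnit i).re = 0 := rfl

@[simp] theorem imUnit_imI (i : Fin 3) : (imUnit i).imI = if i = 0 then 1 else 0 := rfl

@[simp] theorem imUnit_imJ (i : Fin 3) : (imUnit i).imJ = if i = 1 then 1 else 0 := rfl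

@[simp] theorem imUnit_imK (i : Fin 3) : (imUnit i).imK = if i = 2 then 1 else 0 := rfl

/-! ### The invariant orthogonal frame and its structure functions -/

namespace InvariantMetric

variable {J : Set ℝ} (D : InvariantMetric J)

theorem w_pos {t : ℝ} (ht : t ∈ J) (i : Fin 3) : 0 < D.w i t :=
  mul_pos (D.a_pos _ t ht) (D.a_pos _ t ht)

theorem vol_pos {t : ℝ} (ht : t ∈ J) : 0 < D.vol t :=
  mul_pos (mul_pos (D.a_pos _ t ht) (D.a_pos _ t ht)) (D.a_pos _ t ht)

theorem a_mul_w (i : Fin 3) (t : ℝ) : D.a i t * D.w i t = D.vol t := by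
  fin_cases i <;> simp [w, vol] <;> ring

theorem vol_sq (t : ℝ) : D.vol t ^ 2 = D.w 0 t * D.w 1 t * D.w 2 t := by
  simp [w, vol]; ring

theorem contDiffOn_w (i : Fin 3) : ContDiffOn ℝ ∞ (D.w i) J :=
  (D.a_smooth _).mul (D.a_smooth _)

theorem contDiffOn_vol : ContDiffOn ℝ ∞ D.vol J :=
  ((D.a_smooth _).mul (D.a_smooth _)).mul (D.a_smooth _)

theorem R_mul_transpose {t : ℝ} (ht : t ∈ J) : D.R t * (D.R t).transpose = 1 :=
  (Matrix.mem_orthogonalGroup_iff (Fin 3) ℝ).1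
    (Matrix.mem_specialOrthogonalGroup_iff.1 (D.R_mem t ht)).1

theorem transpose_mul_R {t : ℝ} (ht : t ∈ J) : (D.R t).transpose * D.R t = 1 :=
  mul_eq_one_comm.1 (D.R_mul_transpose ht)

theorem R_det {t : ℝ} (ht : t ∈ J) : (D.R t).det = 1 :=
  (Matrix.mem_specialOrthogonalGroup_iff.1 (D.R_mem t ht)).2

theorem R_row {t : ℝ} (ht : t ∈ J) (i j : Fin 3) :
    ∑ l, D.R t i l * D.R t j l = if i = j then 1 else 0 := by
  have := congrFun (congrFun (D.R_mul_transpose ht) i) j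
  simpa [Matrix.mul_apply, Matrix.one_apply] using this

theorem R_col {t : ℝ} (ht : t ∈ J) (i j : Fin 3) :
    ∑ l, D.R t l i * D.R t l j = if i = j then 1 else 0 := by
  have := congrFun (congrFun (D.transpose_mul_R ht) i) j
  simpa [Matrix.mul_apply, Matrix.one_apply] using this

/-- The rows of `R` satisfy the cross product rule. -/
theorem R_cross {t : ℝ} (ht : t ∈ J) (i l : Fin 3) :
    D.R t i (l + 1) * D.R t (i + 1) (l + 2) - D.R t i (l + 2) * D.R t (i + 1) (l + 1) =
      D.R t (i + 2) l := by
  -- The adjugate of a matrix in `SO(3)` is its transpose, and its entries are the cross products of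
  -- the rows.
  have h : (D.R t).adjugate = (D.R t).transpose := by
    have h1 : (D.R t).adjugate * D.R t = 1 := by
      rw [Matrix.adjugate_mul, D.R_det ht, one_smul]
    calc (D.R t).adjugate = (D.R t).adjugate * (D.R t * (D.R t).transpose) := by
          rw [D.R_mul_transpose ht, mul_one]
      _ = _ := by rw [← mul_assoc, h1, one_mul]
  have h2 := congrFun (congrFun h l) (i + 2)
  rw [Matrix.adjugate_fin_three] at h2
  fin_cases i <;> fin_cases l <;> simp [Matrix.transpose_apply] at h2 ⊢ <;> linarith

/-- The matrix `Ṙ Rᵀ`. -/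
def spin (i m : Fin 3) (t : ℝ) : ℝ := ∑ l, deriv (fun s => D.R s i l) t * D.R t m l

variable {D} in
theorem differentiableAt_of_contDiffOn {E : Type*} [NormedAddCommGroup E] [NormedSpace ℝ E]
    {f : ℝ → E} (hJ : IsOpen J) (hf : ContDiffOn ℝ ∞ f J) {t : ℝ} (ht : t ∈ J) :
    DifferentiableAt ℝ f t :=
  (hf.contDiffAt (hJ.mem_nhds ht)).differentiableAt (by simp)

theorem spin_skew (hJ : IsOpen J) {t : ℝ} (ht : t ∈ J) (i m : Fin 3) :
    D.spin i m t = -D.spin m i t := by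
  have hd : ∀ i l, HasDerivAt (fun s => D.R s i l) (deriv (fun s => D.R s i l) t) t :=
    fun i l => (differentiableAt_of_contDiffOn hJ (D.R_smooth i l) ht).hasDerivAt
  have h1 := HasDerivAt.fun_sum (u := Finset.univ) fun l (_ : l ∈ Finset.univ) =>
    (hd i l).mul (hd m l)
  have h2 : (fun s => ∑ l, D.R s i l * D.R s m l) =ᶠ[nhds t] fun _ => if i = m then 1 else 0 := by
    filter_upwards [hJ.mem_nhds ht] with s hs using D.R_row hs i m
  have h3 := (h1.congr_of_eventuallyEq h2.symm).unique (hasDerivAt_const t _)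
  rw [Finset.sum_add_distrib] at h3
  have h4 : D.spin m i t = ∑ l, D.R t i l * deriv (fun s => D.R s m l) t :=
    Finset.sum_congr rfl fun l _ => mul_comm _ _
  rw [h4]
  exact eq_neg_of_add_eq_zero_left h3

/-- This is `Ṙ = (Ṙ Rᵀ) R`. -/
theorem deriv_R {t : ℝ} (ht : t ∈ J) (i l : Fin 3) :
    deriv (fun s => D.R s i l) t = ∑ m, D.spin i m t * D.R t m l := by
  have h : ∀ k, ∑ m, D.R t m k * D.R t m l = if k = l then 1 else 0 := fun k => D.R_col ht k l
  simp only [spin, Finset.sum_mul, mul_assoc]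
  rw [Finset.sum_comm]
  simp [← Finset.mul_sum, h]

/-- The vector fields `x ↦ x * vec i (time x)` and `x ↦ x` form an orthogonal frame in which all
vectors have length `vol`. -/
def vec (i : Fin 3) (t : ℝ) : ℍ := ∑ l, (D.w i t * D.R t i l) • ((-1 / 2 : ℝ) • imUnit l)

theorem contDiffOn_vec (i : Fin 3) : ContDiffOn ℝ ∞ (D.vec i) J :=
  ContDiffOn.sum fun l _ => ((D.contDiffOn_w i).mul (D.R_smooth i l)).smul contDiffOn_const

theorem vec_re (i : Fin 3) (t : ℝ) : (D.vec i t).re = 0 := by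
  simp [vec, Fin.sum_univ_three]

theorem vec_imI (i : Fin 3) (t : ℝ) : (D.vec i t).imI = -(D.w i t * D.R t i 0) / 2 := by
  simp [vec, Fin.sum_univ_three]; ring

theorem vec_imJ (i : Fin 3) (t : ℝ) : (D.vec i t).imJ = -(D.w i t * D.R t i 1) / 2 := by
  simp [vec, Fin.sum_univ_three]; ring

theorem vec_imK (i : Fin 3) (t : ℝ) : (D.vec i t).imK = -(D.w i t * D.R t i 2) / 2 := by
  simp [vec, Fin.sum_univ_three]; ring

/-- The structure functions of the brackets of `x ↦ x` with `x ↦ x * vec i (time x)`. -/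
def struct (i m : Fin 3) (t : ℝ) : ℝ :=
  (if i = m then deriv (D.w i) t / D.w i t else 0) + D.w i t * D.spin i m t / D.w m t

theorem deriv_vec (hJ : IsOpen J) {t : ℝ} (ht : t ∈ J) (i : Fin 3) :
    deriv (D.vec i) t = ∑ m, D.struct i m t • D.vec m t := by
  have hd : ∀ l, HasDerivAt (fun s => D.R s i l) (deriv (fun s => D.R s i l) t) t :=
    fun l => (differentiableAt_of_contDiffOn hJ (D.R_smooth i l) ht).hasDerivAt
  have hw := (differentiableAt_of_contDiffOn hJ (D.contDiffOn_w i) ht).hasDerivAt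
  have h1 : HasDerivAt (D.vec i) _ t :=
    HasDerivAt.fun_sum (u := Finset.univ) fun l _ =>
      (hw.mul (hd l)).smul_const ((-1 / 2 : ℝ) • imUnit l)
  rw [h1.deriv]
  simp only [vec, Finset.smul_sum]
  rw [Finset.sum_comm]
  refine Finset.sum_congr rfl fun l _ => ?_
  simp only [smul_smul _ _ ((-1 / 2 : ℝ) • imUnit l)]
  rw [← Finset.sum_smul, D.deriv_R ht]
  congr 1
  simp only [struct, add_mul, Finset.sum_add_distrib, Finset.mul_sum]
  congr 1
  · simp
    field_simp [(D.w_pos ht i).ne']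
  · refine Finset.sum_congr rfl fun m _ => ?_
    field_simp [(D.w_pos ht m).ne']

/-- The commutator of imaginary quaternions is twice their cross product, and rows of `R` obey the
cross product rule; with the normalization `-1/2` in `vec`, the remaining constant is `-1`. -/
theorem vec_comm {t : ℝ} (ht : t ∈ J) (i : Fin 3) :
    D.vec i t * D.vec (i + 1) t - D.vec (i + 1) t * D.vec i t =
      -(D.w i t * D.w (i + 1) t / D.w (i + 2) t) • D.vec (i + 2) t := by
  have h : ∀ l, D.R t (i + 2) l = D.R t i (l + 1) * D.R t (i + 1) (l + 2) -
    D.R t i (l + 2) * D.R t (i + 1) (l + 1) := fun l => (D.R_cross ht i l).symm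
  have hw := (D.w_pos ht (i + 2)).ne'
  have h0 := h 0
  have h1 := h 1
  have h2 := h 2
  simp only [Fin.reduceAdd] at h0 h1 h2
  ext <;> simp [vec_re, vec_imI, vec_imJ, vec_imK, h0, h1, h2] <;> field_simp <;> ring

theorem leftBracket_one_vec (hJ : IsOpen J) {t : ℝ} (ht : t ∈ J) (i : Fin 3) :
    leftBracket (fun _ => 1) (D.vec i) t = ∑ m, D.struct i m t • D.vec m t := by
  simp [leftBracket, D.deriv_vec hJ ht]

theorem leftBracket_vec_vec {t : ℝ} (ht : t ∈ J) (i : Fin 3) :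
    leftBracket (D.vec i) (D.vec (i + 1)) t =
      -(D.w i t * D.w (i + 1) t / D.w (i + 2) t) • D.vec (i + 2) t := by
  simp [leftBracket, D.vec_comm ht, vec_re]

/-! ### The coframe on the invariant frame -/

theorem frame_zero (q : ℍ) :
    D.frame 0 q = (D.vol (time q))⁻¹ • leftField (fun _ => 1) q := by
  simp [frame, leftField]

theorem frame_succ {q : ℍ} (hq : q ∈ cylinder J) (i : Fin 3) :
    D.frame i.succ q = (D.vol (time q))⁻¹ • leftField (D.vec i) q := by
  have h1 : (D.vol (time q))⁻¹ * D.w i (time q) = (D.a i (time q))⁻¹ := by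
    rw [← D.a_mul_w i]
    field_simp [(D.w_pos hq.2 i).ne', (D.a_pos i _ hq.2).ne']
  simp only [frame, Fin.cons_succ, leftField, vec, Finset.mul_sum, mul_smul_comm,
    Finset.smul_sum, smul_smul]
  refine Finset.sum_congr rfl fun l _ => ?_
  rw [← h1]
  congr 1
  ring

theorem sigma_mul {q : ℍ} (hq : q ≠ 0) (l : Fin 3) (v : ℍ) :
    sigma l q (q * v) = -2 * imComp l v := by
  simp [sigma, hq]

theorem imComp_vec (l i : Fin 3) (t : ℝ) :
    imComp l (D.vec i t) = -(D.w i t * D.R t i l) / 2 := by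
  rw [imComp_apply]
  fin_cases l <;> simp [vec_imI, vec_imJ, vec_imK]

theorem coframe_zero_mul {q : ℍ} (hq : q ≠ 0) (v : ℍ) :
    D.coframe 0 q (q * v) = D.vol (time q) * v.re := by
  simp [coframe, dt_mul hq]

theorem coframe_succ_mul {q : ℍ} (hq : q ≠ 0) (i : Fin 3) (v : ℍ) :
    D.coframe i.succ q (q * v) =
      -2 * D.a i (time q) * ∑ l, D.R (time q) i l * imComp l v := by
  simp only [coframe, Fin.cons_succ, sigmaTilde, smul_apply, sum_apply,
    sigma_mul hq, smul_eq_mul, Finset.mul_sum]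
  refine Finset.sum_congr rfl fun l _ => ?_
  ring

theorem coframe_zero_one {q : ℍ} (hq : q ∈ cylinder J) :
    D.coframe 0 q (leftField (fun _ => 1) q) = D.vol (time q) := by
  rw [leftField, coframe_zero_mul D hq.1]; simp

theorem coframe_zero_vec {q : ℍ} (hq : q ∈ cylinder J) (i : Fin 3) :
    D.coframe 0 q (leftField (D.vec i) q) = 0 := by
  simp [leftField, coframe_zero_mul D hq.1, vec_re]

theorem coframe_succ_one {q : ℍ} (hq : q ∈ cylinder J) (i : Fin 3) :
    D.coframe i.succ q (leftField (fun _ => 1) q) = 0 := by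
  rw [leftField, coframe_succ_mul D hq.1]
  simp [imComp_apply, Fin.sum_univ_three]

theorem coframe_succ_vec {q : ℍ} (hq : q ∈ cylinder J) (i j : Fin 3) :
    D.coframe i.succ q (leftField (D.vec j) q) = if i = j then D.vol (time q) else 0 := by
  have h := D.R_row hq.2 i j
  rw [leftField, coframe_succ_mul D hq.1]
  simp only [imComp_vec]
  calc _ = D.a i (time q) * D.w j (time q) * ∑ l, D.R (time q) i l * D.R (time q) j l := by
        simp only [Fin.sum_univ_three]; ring
    _ = _ := by
        rw [h]; split_ifs with e
        · rw [← e, a_mul_w, mul_one]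
        · simp

theorem metric_eq (q v w : ℍ) : D.metric q v w = ∑ i, D.coframe i q v * D.coframe i q w := by
  rw [Fin.sum_univ_succ]
  simp only [metric, coframe, Fin.cons_zero, Fin.cons_succ, add_apply, smul_apply,
    ContinuousLinearMap.smulRight_apply, sum_apply, smul_eq_mul]
  congr 1
  · ring
  · exact Finset.sum_congr rfl fun i _ => by ring

/-- The expansion of a vector in the invariant frame. -/
theorem eq_sum_coframe {q : ℍ} (hq : q ∈ cylinder J) (v : ℍ) :
    v = (D.vol (time q))⁻¹ • (D.coframe 0 q v • leftField (fun _ => 1) q +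
      ∑ i : Fin 3, D.coframe i.succ q v • leftField (D.vec i) q) := by
  obtain ⟨z, rfl⟩ : ∃ z, v = q * z := ⟨q⁻¹ * v, by rw [mul_inv_cancel_left₀ hq.1]⟩
  have hv := (D.vol_pos hq.2).ne'
  have h := fun k l => D.R_col hq.2 k l
  simp only [Fin.sum_univ_three] at h
  have e := fun i => D.a_mul_w i (time q)
  simp only [coframe_zero_mul D hq.1, coframe_succ_mul D hq.1, leftField, ← mul_smul_comm,
    ← Finset.mul_sum, ← mul_add]
  congr 1
  -- Orthonormality of the columns of `R` inverts the rotation, and `aᵢ wᵢ = abc` cancels the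
  -- scaling.
  have key : ∀ k : Fin 3, imComp k z = (D.vol (time q))⁻¹ * ∑ i : Fin 3,
      (-2 * D.a i (time q) * ∑ l, D.R (time q) i l * imComp l z) *
        (-(D.w i (time q) * D.R (time q) i k) / 2) := by
    intro k
    have hk : imComp k z = ∑ l, (D.R (time q) 0 k * D.R (time q) 0 l +
        D.R (time q) 1 k * D.R (time q) 1 l + D.R (time q) 2 k * D.R (time q) 2 l) *
          imComp l z := by simp [h]
    rw [eq_inv_mul_iff_mul_eq₀ hv]
    simp only [Fin.sum_univ_three] at hk ⊢
    linear_combination D.vol (time q) * hk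
      - (D.R (time q) 0 k * (D.R (time q) 0 0 * imComp 0 z + D.R (time q) 0 1 * imComp 1 z +
        D.R (time q) 0 2 * imComp 2 z)) * e 0
      - (D.R (time q) 1 k * (D.R (time q) 1 0 * imComp 0 z + D.R (time q) 1 1 * imComp 1 z +
        D.R (time q) 1 2 * imComp 2 z)) * e 1
      - (D.R (time q) 2 k * (D.R (time q) 2 0 * imComp 0 z + D.R (time q) 2 1 * imComp 1 z +
        D.R (time q) 2 2 * imComp 2 z)) * e 2
  have c0 : imComp 0 z = z.imI := imComp_apply 0 z
  have k0 := key 0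
  have c1 : imComp 1 z = z.imJ := imComp_apply 1 z
  have k1 := key 1
  have c2 : imComp 2 z = z.imK := imComp_apply 2 z
  have k2 := key 2
  simp only [Fin.sum_univ_three] at k0 k1 k2 ⊢
  ext
  · simp [vec_re]; field_simp
  · simp only [Quaternion.imI_smul, Quaternion.imI_add, smul_eq_mul, vec_imI, Quaternion.imI_one]
    linear_combination k0 - c0
  · simp only [Quaternion.imJ_smul, Quaternion.imJ_add, smul_eq_mul, vec_imJ, Quaternion.imJ_one]
    linear_combination k1 - c1
  · simp only [Quaternion.imK_smul, Quaternion.imK_add, smul_eq_mul, vec_imK, Quaternion.imK_one]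
    linear_combination k2 - c2

end InvariantMetric

/-! ### Base points `exp t` and differentiability of the coframe -/

theorem time_coe_exp (t : ℝ) : time ((Real.exp t : ℝ) : ℍ) = t := by
  simp [time]

theorem coe_exp_mem {J : Set ℝ} {t : ℝ} (ht : t ∈ J) : ((Real.exp t : ℝ) : ℍ) ∈ cylinder J :=
  ⟨fun h => (Real.exp_pos t).ne' (congrArg QuaternionAlgebra.re h), by rwa [time_coe_exp]⟩

theorem differentiableAt_sigma {q : ℍ} (hq : q ≠ 0) (l : Fin 3) :
    DifferentiableAt ℝ (sigma l) q := by
  have h1 : DifferentiableAt ℝ (fun x : ℍ => x⁻¹) q := differentiableAt_inv hq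
  have h2 : DifferentiableAt ℝ (fun x : ℍ => ContinuousLinearMap.mul ℝ ℍ x⁻¹) q :=
    (ContinuousLinearMap.mul ℝ ℍ).differentiableAt.comp q h1
  exact ((differentiableAt_const (imComp l)).clm_comp h2).const_smul (-2 : ℝ)

theorem differentiableAt_smul_clm {E : Type*} [NormedAddCommGroup E] [NormedSpace ℝ E]
    {c : E → ℝ} {η : E → E →L[ℝ] ℝ} {q : E} (hc : DifferentiableAt ℝ c q)
    (hη : DifferentiableAt ℝ η q) : DifferentiableAt ℝ (fun x => c x • η x) q :=
  hc.smul hη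

theorem differentiableAt_sum_clm {E ι : Type*} [Fintype ι] [NormedAddCommGroup E]
    [NormedSpace ℝ E] {η : ι → E → E →L[ℝ] ℝ} {q : E} (hη : ∀ i, DifferentiableAt ℝ (η i) q) :
    DifferentiableAt ℝ (fun x => ∑ i, η i x) q :=
  DifferentiableAt.fun_sum fun i _ => hη i

theorem differentiableAt_dt {q : ℍ} (hq : q ≠ 0) : DifferentiableAt ℝ dt q :=
  ((contDiffAt_time hq).fderiv_right (m := ∞) le_rfl).differentiableAt (by simp)

namespace InvariantMetric

variable {J : Set ℝ} (D : InvariantMetric J)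

theorem differentiableAt_coframe (hJ : IsOpen J) {q : ℍ} (hq : q ∈ cylinder J) (i : Fin 4) :
    DifferentiableAt ℝ (D.coframe i) q := by
  have ht := differentiableAt_time hq.1
  have hc : ∀ {f : ℝ → ℝ}, ContDiffOn ℝ ∞ f J → DifferentiableAt ℝ (fun x => f (time x)) q :=
    fun hf => (differentiableAt_of_contDiffOn hJ hf hq.2).comp q ht
  refine Fin.cases ?_ (fun i => ?_) i
  · exact differentiableAt_smul_clm (hc D.contDiffOn_vol) (differentiableAt_dt hq.1)
  · have : DifferentiableAt ℝ (D.sigmaTilde i) q :=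
      differentiableAt_sum_clm fun l =>
        differentiableAt_smul_clm (hc (D.R_smooth i l)) (differentiableAt_sigma hq.1 l)
    exact differentiableAt_smul_clm (hc (D.a_smooth i)) this

theorem differentiableAt_vec (hJ : IsOpen J) {t : ℝ} (ht : t ∈ J) (i : Fin 3) :
    DifferentiableAt ℝ (D.vec i) t :=
  differentiableAt_of_contDiffOn hJ (D.contDiffOn_vec i) ht

/-! ### The shape matrix and the rotation vector -/

/-- The functions `wⱼ wₖ / wᵢ`. -/
def ratio (i : Fin 3) (t : ℝ) : ℝ := D.w (i + 1) t * D.w (i + 2) t / D.w i t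

/-- The symmetric matrix that describes the connection of the bundle of self-dual forms. -/
def shape (r s : Fin 3) (t : ℝ) : ℝ :=
  if r = s then D.alpha r t else -(D.struct r s t + D.struct s r t) / 2

/-- The rotation of the invariant frame of the bundle of self-dual forms. -/
def rot (r : Fin 3) (t : ℝ) : ℝ := (D.struct (r + 1) (r + 2) t - D.struct (r + 2) (r + 1) t) / 2

theorem shape_symm (r s : Fin 3) (t : ℝ) : D.shape r s t = D.shape s r t := by
  unfold shape
  rcases eq_or_ne r s with h | h
  · rw [h]
  · rw [if_neg h, if_neg h.symm, add_comm]

theorem shape_self (r : Fin 3) (t : ℝ) : D.shape r r t = D.alpha r t := if_pos rfl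

/-- The defining equations of `α` enter here; the spin term drops out because `Ṙ Rᵀ` is skew. -/
theorem struct_self (hJ : IsOpen J) {t : ℝ} (ht : t ∈ J) (i : Fin 3) :
    D.struct i i t = -D.ratio i t + D.alpha (i + 1) t + D.alpha (i + 2) t := by
  have h : D.spin i i t = 0 := by have := D.spin_skew hJ ht i i; linarith
  have hw := (D.w_pos ht i).ne'
  rw [struct, h, D.deriv_w ht, ratio]
  simp
  field_simp
  ring

/-- Together with `struct_self` and `struct_cyc'` this reads `struct = T - diag(ratio) - S + K`,
where `S` is `shape`, `T` its trace and `K` the skew matrix of `rot`. -/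
theorem struct_cyc (i : Fin 3) (t : ℝ) :
    D.struct i (i + 1) t = D.rot (i + 2) t - D.shape i (i + 1) t := by
  have h : ∀ i : Fin 3, i ≠ i + 1 := by decide
  rw [shape, rot, if_neg (h i)]
  have h1 : i + 2 + 1 = i := by revert i; decide
  have h2 : i + 2 + 2 = i + 1 := by revert i; decide
  rw [h1, h2]; ring

theorem struct_cyc' (i : Fin 3) (t : ℝ) :
    D.struct (i + 1) i t = -D.rot (i + 2) t - D.shape i (i + 1) t := by
  have h : ∀ i : Fin 3, i ≠ i + 1 := by decide
  rw [shape, rot, if_neg (h i)]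
  have h1 : i + 2 + 1 = i := by revert i; decide
  have h2 : i + 2 + 2 = i + 1 := by revert i; decide
  rw [h1, h2]; ring

/-- Logarithmic derivative of `vol² = w₁ w₂ w₃`. -/
theorem deriv_vol (hJ : IsOpen J) {t : ℝ} (ht : t ∈ J) :
    2 * deriv D.vol t = D.vol t * ∑ i, D.struct i i t := by
  have hv : HasDerivAt D.vol _ t :=
    (differentiableAt_of_contDiffOn hJ D.contDiffOn_vol ht).hasDerivAt
  have hw := fun i => (differentiableAt_of_contDiffOn hJ (D.contDiffOn_w i) ht).hasDerivAt
  have h1 := hv.pow 2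
  have h2 := ((hw 0).mul (hw 1)).mul (hw 2)
  have h3 : D.vol ^ 2 = D.w 0 * D.w 1 * D.w 2 := by ext s; simpa using D.vol_sq s
  rw [h3] at h1
  have h4 := h1.unique h2
  have hs : ∀ i, D.struct i i t = deriv (D.w i) t / D.w i t := by
    intro i
    have h : D.spin i i t = 0 := by have := D.spin_skew hJ ht i i; linarith
    simp [struct, h]
  have hv' := (D.vol_pos ht).ne'
  have w0 := (D.w_pos ht 0).ne'
  have w1 := (D.w_pos ht 1).ne'
  have w2 := (D.w_pos ht 2).ne'
  rw [Fin.sum_univ_three, hs, hs, hs]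
  have h5 := D.vol_sq t
  simp at h4
  apply mul_left_cancel₀ hv'
  calc _ = 2 * D.vol t * deriv D.vol t := by ring
    _ = _ := h4
    _ = D.vol t ^ 2 * (deriv (D.w 0) t / D.w 0 t + deriv (D.w 1) t / D.w 1 t +
          deriv (D.w 2) t / D.w 2 t) := by rw [h5]; field_simp
    _ = _ := by ring

/-! ### Exterior derivatives of the coframe -/

theorem eventually_mem (hJ : IsOpen J) {q : ℍ} (hq : q ∈ cylinder J) :
    ∀ᶠ x in nhds q, x ∈ cylinder J := (isOpen_cylinder hJ).mem_nhds hq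

theorem apply_leftField_sum {η : ℍ →L[ℝ] ℝ} {q : ℍ} {v : ℝ → ℍ} {c : Fin 3 → ℝ}
    (h : v (time q) = ∑ m, c m • D.vec m (time q)) :
    η (leftField v q) = ∑ m, c m * η (leftField (D.vec m) q) := by
  simp [leftField, h, Finset.mul_sum]

/-- Cartan's formula for a one-form with invariant components, on `x ↦ x` and
`x ↦ x * vec i (time x)`. -/
theorem dOne_one_vec (hJ : IsOpen J) {q : ℍ} (hq : q ∈ cylinder J) {η : ℍ → ℍ →L[ℝ] ℝ}
    (hη : DifferentiableAt ℝ η q) {φ₀ : ℝ → ℝ} {φ : Fin 3 → ℝ → ℝ}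
    (hφ₀ : DifferentiableAt ℝ φ₀ (time q)) (hφ : ∀ i, DifferentiableAt ℝ (φ i) (time q))
    (h₀ : ∀ x ∈ cylinder J, η x (leftField (fun _ => 1) x) = φ₀ (time x))
    (h : ∀ x ∈ cylinder J, ∀ i, η x (leftField (D.vec i) x) = φ i (time x)) (i : Fin 3) :
    dOne η q (leftField (fun _ => 1) q) (leftField (D.vec i) q) =
      deriv (φ i) (time q) - ∑ m, D.struct i m (time q) * φ m (time q) := by
  have hn := eventually_mem hJ hq
  rw [dOne_leftField hq.1 hη (differentiableAt_const _) (D.differentiableAt_vec hJ hq.2 i)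
    hφ₀ (hφ i) (hn.mono h₀) (hn.mono fun x hx => h x hx i),
    D.apply_leftField_sum (D.leftBracket_one_vec hJ hq.2 i)]
  simp [vec_re, h q hq]

/-- Cartan's formula for a one-form with invariant components, on `x ↦ x * vec i (time x)` and
its cyclic successor. -/
theorem dOne_vec_vec (hJ : IsOpen J) {q : ℍ} (hq : q ∈ cylinder J) {η : ℍ → ℍ →L[ℝ] ℝ}
    (hη : DifferentiableAt ℝ η q) {φ : Fin 3 → ℝ → ℝ}
    (hφ : ∀ i, DifferentiableAt ℝ (φ i) (time q))
    (h : ∀ x ∈ cylinder J, ∀ i, η x (leftField (D.vec i) x) = φ i (time x)) (i : Fin 3) :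
    dOne η q (leftField (D.vec (i + 1)) q) (leftField (D.vec (i + 2)) q) =
      D.ratio i (time q) * φ i (time q) := by
  have hn := eventually_mem hJ hq
  have e1 : i + 1 + 1 = i + 2 := by revert i; decide
  have e2 : i + 1 + 2 = i := by revert i; decide
  have hb := D.leftBracket_vec_vec hq.2 (i + 1)
  rw [e1, e2] at hb
  rw [dOne_leftField hq.1 hη (D.differentiableAt_vec hJ hq.2 _) (D.differentiableAt_vec hJ hq.2 _)
    (hφ _) (hφ _) (hn.mono fun x hx => h x hx _) (hn.mono fun x hx => h x hx _)]
  simp only [vec_re]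
  rw [leftField, hb, mul_smul_comm, map_smul]
  have := h q hq i
  rw [leftField] at this
  rw [this, ratio, smul_eq_mul]
  ring

/-- The generators of the invariant frame. -/
def fr : Fin 4 → ℝ → ℍ := Fin.cons (fun _ => 1) D.vec

theorem fr_zero : D.fr 0 = fun _ => 1 := rfl

theorem fr_succ (i : Fin 3) : D.fr i.succ = D.vec i := rfl

theorem coframe_fr {q : ℍ} (hq : q ∈ cylinder J) (i j : Fin 4) :
    D.coframe i q (leftField (D.fr j) q) = if i = j then D.vol (time q) else 0 := by
  refine Fin.cases ?_ (fun i => ?_) i <;> refine Fin.cases ?_ (fun j => ?_) j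
  · simpa [fr_zero] using D.coframe_zero_one hq
  · simpa [fr_succ, (Fin.succ_ne_zero j).symm] using D.coframe_zero_vec hq j
  · simpa [fr_zero] using D.coframe_succ_one hq i
  · simpa [fr_succ] using D.coframe_succ_vec hq i j

theorem frame_eq {q : ℍ} (hq : q ∈ cylinder J) (i : Fin 4) :
    D.frame i q = (D.vol (time q))⁻¹ • leftField (D.fr i) q := by
  refine Fin.cases ?_ (fun i => ?_) i
  · exact D.frame_zero q
  · exact D.frame_succ hq i

theorem differentiableAt_vol (hJ : IsOpen J) {t : ℝ} (ht : t ∈ J) : DifferentiableAt ℝ D.vol t :=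
  differentiableAt_of_contDiffOn hJ D.contDiffOn_vol ht

theorem dOne_coframe_zero_one (hJ : IsOpen J) {q : ℍ} (hq : q ∈ cylinder J) (j : Fin 3) :
    dOne (D.coframe 0) q (leftField (D.fr 0) q) (leftField (D.fr j.succ) q) = 0 := by
  rw [fr_zero, fr_succ, D.dOne_one_vec hJ hq (D.differentiableAt_coframe hJ hq 0)
    (φ₀ := D.vol) (φ := fun _ _ => 0) (D.differentiableAt_vol hJ hq.2)
    (fun _ => differentiableAt_const _) (fun x hx => D.coframe_zero_one hx)
    (fun x hx i => D.coframe_zero_vec hx i)]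
  simp

theorem dOne_coframe_zero_vec (hJ : IsOpen J) {q : ℍ} (hq : q ∈ cylinder J) (j : Fin 3) :
    dOne (D.coframe 0) q (leftField (D.fr (j + 1).succ) q) (leftField (D.fr (j + 2).succ) q)
      = 0 := by
  rw [fr_succ, fr_succ, D.dOne_vec_vec hJ hq (D.differentiableAt_coframe hJ hq 0)
    (φ := fun _ _ => 0) (fun _ => differentiableAt_const _)
    (fun x hx i => D.coframe_zero_vec hx i)]
  simp

theorem dOne_coframe_succ_one (hJ : IsOpen J) {q : ℍ} (hq : q ∈ cylinder J) (i j : Fin 3) :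
    dOne (D.coframe i.succ) q (leftField (D.fr 0) q) (leftField (D.fr j.succ) q) =
      D.vol (time q) * ((if i = j then (∑ m, D.struct m m (time q)) / 2 else 0)
        - D.struct j i (time q)) := by
  have hv := D.differentiableAt_vol hJ hq.2
  rw [fr_zero, fr_succ, D.dOne_one_vec hJ hq (D.differentiableAt_coframe hJ hq i.succ)
    (φ₀ := fun _ => 0) (φ := fun k t => if i = k then D.vol t else 0) (differentiableAt_const _)
    (fun k => by by_cases h : i = k <;> simp [h, hv]) (fun x hx => D.coframe_succ_one hx i)
    (fun x hx k => D.coframe_succ_vec hx i k)]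
  have h2 := D.deriv_vol hJ hq.2
  by_cases h : i = j
  · subst h
    simp
    linarith
  · simp [h, mul_comm]

theorem dOne_coframe_succ_vec (hJ : IsOpen J) {q : ℍ} (hq : q ∈ cylinder J) (i j : Fin 3) :
    dOne (D.coframe i.succ) q (leftField (D.fr (j + 1).succ) q)
        (leftField (D.fr (j + 2).succ) q) =
      D.vol (time q) * (if i = j then D.ratio j (time q) else 0) := by
  have hv := D.differentiableAt_vol hJ hq.2
  rw [fr_succ, fr_succ, D.dOne_vec_vec hJ hq (D.differentiableAt_coframe hJ hq i.succ)
    (φ := fun k t => if i = k then D.vol t else 0)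
    (fun k => by by_cases h : i = k <;> simp [h, hv])
    (fun x hx k => D.coframe_succ_vec hx i k)]
  by_cases h : i = j <;> simp [h, mul_comm]

/-! ### Connection and curvature of the bundle of self-dual forms -/

variable {conn : Fin 4 → Fin 4 → ℍ → ℍ →L[ℝ] ℝ}

theorem torsion_fr (hc : D.IsConnectionForm conn) {q : ℍ} (hq : q ∈ cylinder J)
    (i k l : Fin 4) :
    dOne (D.coframe i) q (leftField (D.fr k) q) (leftField (D.fr l) q) +
      D.vol (time q) * (conn i l q (leftField (D.fr k) q) - conn i k q (leftField (D.fr l) q))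
        = 0 := by
  rw [← hc.torsion_free i q hq (leftField (D.fr k) q) (leftField (D.fr l) q)]
  simp [wedge, D.coframe_fr hq]
  ring

/-- The connection forms of the bundle of self-dual two-forms. -/
def sdConn (conn : Fin 4 → Fin 4 → ℍ → ℍ →L[ℝ] ℝ) (r : Fin 3) (q : ℍ) : ℍ →L[ℝ] ℝ :=
  conn 0 r.succ q - conn (r + 1).succ (r + 2).succ q

/-- Solution of the structure equations for the connection of the self-dual forms. -/
theorem sdConn_fr (hJ : IsOpen J) (hc : D.IsConnectionForm conn) {q : ℍ}
    (hq : q ∈ cylinder J) (r : Fin 3) :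
    sdConn conn r q (leftField (D.fr 0) q) = D.rot r (time q) ∧
    ∀ s : Fin 3, sdConn conn r q (leftField (D.fr s.succ) q) = -D.shape r s (time q) := by
  have hv := (D.vol_pos hq.2).ne'
  set g : Fin 4 → Fin 4 → Fin 4 → ℝ := fun i j k => conn i j q (leftField (D.fr k) q) with hg
  have skew : ∀ i j k, g i j k = -g j i k := fun i j k => by
    have := congrArg (fun f => f (leftField (D.fr k) q)) (hc.skew i j q hq)
    simp only [add_apply, zero_apply] at this
    exact eq_neg_of_add_eq_zero_left this
  -- `T0` and `T1` are the torsion equations of `e⁰`, `T2` and `T3` those of `eⁱ`. With skewness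
  -- they form a linear system for the components of the connection, as in the Koszul formula.
  have T0 : ∀ j : Fin 3, g 0 j.succ 0 = 0 := fun j => by
    have := D.torsion_fr hc hq 0 0 j.succ
    rw [D.dOne_coframe_zero_one hJ hq] at this
    have h0 := skew 0 0 j.succ
    have h1 : g 0 j.succ 0 - g 0 0 j.succ = 0 := by simpa [hv] using this
    linarith
  have T1 : ∀ j : Fin 3, g 0 (j + 2).succ (j + 1).succ =
      g 0 (j + 1).succ (j + 2).succ := fun j => by
    have := D.torsion_fr hc hq 0 (j + 1).succ (j + 2).succ
    rw [D.dOne_coframe_zero_vec hJ hq] at this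
    have h1 : g 0 (j + 2).succ (j + 1).succ - g 0 (j + 1).succ (j + 2).succ = 0 := by
      simpa [hv] using this
    linarith
  have T2 : ∀ i j : Fin 3, (if i = j then (∑ m, D.struct m m (time q)) / 2 else 0)
        - D.struct j i (time q) + g i.succ j.succ 0 + g 0 i.succ j.succ = 0 := fun i j => by
    have := D.torsion_fr hc hq i.succ 0 j.succ
    rw [D.dOne_coframe_succ_one hJ hq, ← mul_add] at this
    have h1 := (mul_eq_zero.1 this).resolve_left hv
    have h2 := skew i.succ 0 j.succ
    simp only [hg] at h2 ⊢
    linarith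
  have T3 : ∀ i j : Fin 3, (if i = j then D.ratio j (time q) else 0) +
      g i.succ (j + 2).succ (j + 1).succ - g i.succ (j + 1).succ (j + 2).succ = 0 := fun i j => by
    have := D.torsion_fr hc hq i.succ (j + 1).succ (j + 2).succ
    rw [D.dOne_coframe_succ_vec hJ hq, ← mul_add] at this
    have h1 := (mul_eq_zero.1 this).resolve_left hv
    simp only [hg] at h1 ⊢
    linarith
  have hs : ∀ (r : Fin 3) k, sdConn conn r q (leftField (D.fr k) q) =
    g 0 r.succ k - g (r + 1).succ (r + 2).succ k := fun r k => rfl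
  have sk : ∀ (i j : Fin 3) k, g i.succ j.succ k = -g j.succ i.succ k := fun i j k => skew _ _ _
  have ss := fun i => D.struct_self hJ hq.2 i
  constructor
  · rw [hs, T0, rot]
    have h1 := T2 (r + 1) (r + 2)
    have h2 := T2 (r + 2) (r + 1)
    have h3 := T1 r
    have h4 := sk (r + 1) (r + 2) 0
    have e : ∀ r : Fin 3, r + 1 ≠ r + 2 := by decide
    rw [if_neg (e r)] at h1
    rw [if_neg (e r).symm] at h2
    linarith
  · intro s
    rw [hs, shape]
    simp only [Fin.sum_univ_three, ss] at T2
    have d : ∀ i k, g i i k = 0 := fun i k => by have := skew i i k; linarith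
    have T2' := T2 r s
    have T2'' := T2 s r
    have k1 := sk 0 1
    have k2 := sk 1 2
    have k3 := sk 2 0
    have t1 := T1 0
    have t2 := T1 1
    have t3 := T1 2
    fin_cases r <;> fin_cases s <;>
    simp [Fin.forall_fin_succ, d, ss] at T3 T2' T2'' k1 k2 k3 t1 t2 t3 ⊢ <;> linarith

theorem contDiffOn_deriv (hJ : IsOpen J) {f : ℝ → ℝ} (hf : ContDiffOn ℝ ∞ f J) :
    ContDiffOn ℝ ∞ (deriv f) J :=
  hf.deriv_of_isOpen hJ le_rfl

theorem contDiffOn_alpha (hJ : IsOpen J) (i : Fin 3) : ContDiffOn ℝ ∞ (D.alpha i) J := by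
  have h : ∀ i, ContDiffOn ℝ ∞ (D.alphaSum i) J := fun i =>
    ((contDiffOn_deriv hJ (D.contDiffOn_w i)).add
      ((D.contDiffOn_w _).mul (D.contDiffOn_w _))).div (D.contDiffOn_w i)
        fun t ht => (D.w_pos ht i).ne'
  exact (((h _).add (h _)).sub (h _)).div_const 2

theorem contDiffOn_spin (hJ : IsOpen J) (i m : Fin 3) : ContDiffOn ℝ ∞ (D.spin i m) J :=
  ContDiffOn.sum fun l _ => (contDiffOn_deriv hJ (D.R_smooth i l)).mul (D.R_smooth m l)

theorem contDiffOn_struct (hJ : IsOpen J) (i m : Fin 3) : ContDiffOn ℝ ∞ (D.struct i m) J := by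
  refine ContDiffOn.add ?_ (((D.contDiffOn_w i).mul (D.contDiffOn_spin hJ i m)).div
    (D.contDiffOn_w m) fun t ht => (D.w_pos ht m).ne')
  by_cases h : i = m
  · simp only [h, if_true]
    exact (contDiffOn_deriv hJ (D.contDiffOn_w m)).div (D.contDiffOn_w m)
      fun t ht => (D.w_pos ht m).ne'
  · simp only [h, if_false]
    exact contDiffOn_const

theorem contDiffOn_shape (hJ : IsOpen J) (r s : Fin 3) : ContDiffOn ℝ ∞ (D.shape r s) J := by
  by_cases h : r = s
  · exact (D.contDiffOn_alpha hJ r).congr fun t _ => by simp [shape, h]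
  · refine ContDiffOn.congr (f := fun t => -(D.struct r s t + D.struct s r t) / 2) ?_
      fun t _ => by simp [shape, h]
    exact (((D.contDiffOn_struct hJ r s).add (D.contDiffOn_struct hJ s r)).neg).div_const 2

theorem contDiffOn_rot (hJ : IsOpen J) (r : Fin 3) : ContDiffOn ℝ ∞ (D.rot r) J :=
  ((D.contDiffOn_struct hJ _ _).sub (D.contDiffOn_struct hJ _ _)).div_const 2

theorem differentiableAt_shape (hJ : IsOpen J) {t : ℝ} (ht : t ∈ J) (r s : Fin 3) :
    DifferentiableAt ℝ (D.shape r s) t :=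
  differentiableAt_of_contDiffOn hJ (D.contDiffOn_shape hJ r s) ht

theorem differentiableAt_conn (hJ : IsOpen J) (hc : D.IsConnectionForm conn) {q : ℍ}
    (hq : q ∈ cylinder J) (i j : Fin 4) : DifferentiableAt ℝ (conn i j) q :=
  ((hc.smooth i j).contDiffAt ((isOpen_cylinder hJ).mem_nhds hq)).differentiableAt (by simp)

/-- The curvature of the bundle of self-dual two-forms. -/
def sdCurv (conn : Fin 4 → Fin 4 → ℍ → ℍ →L[ℝ] ℝ) (r : Fin 3) (q v w : ℍ) : ℝ :=
  dOne (sdConn conn r) q v w + wedge (sdConn conn (r + 1) q) (sdConn conn (r + 2) q) v w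

/-- This is the splitting `so(4) = so(3) ⊕ so(3)`: in the self-dual combination of curvature forms
the quadratic terms involve only the self-dual connection forms. -/
theorem sdCurv_eq (hJ : IsOpen J) (hc : D.IsConnectionForm conn) {q : ℍ} (hq : q ∈ cylinder J)
    (r : Fin 3) (v w : ℍ) :
    sdCurv conn r q v w =
      (dOne (conn 0 r.succ) q v w + ∑ m, wedge (conn 0 m q) (conn m r.succ q) v w) -
      (dOne (conn (r + 1).succ (r + 2).succ) q v w +
        ∑ m, wedge (conn (r + 1).succ m q) (conn m (r + 2).succ q) v w) := by
  have hd := fun i j => D.differentiableAt_conn hJ hc hq i j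
  have skew : ∀ i j v, conn i j q v = -conn j i q v := fun i j v => by
    have := congrArg (fun f => f v) (hc.skew i j q hq)
    simp only [add_apply, zero_apply] at this
    exact eq_neg_of_add_eq_zero_left this
  have diag : ∀ i v, conn i i q v = 0 := fun i v => by have := skew i i v; linarith
  have h1 : dOne (sdConn conn r) q v w = dOne (conn 0 r.succ) q v w -
    dOne (conn (r + 1).succ (r + 2).succ) q v w := dOne_sub (hd _ _) (hd _ _) v w
  rw [sdCurv, h1]
  have s1 := fun v => skew 1 0 v
  have s2 := fun v => skew 2 0 v
  have s3 := fun v => skew 3 0 v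
  have s4 := fun v => skew 2 1 v
  have s5 := fun v => skew 3 1 v
  have s6 := fun v => skew 3 2 v
  fin_cases r <;>
    simp [wedge, sdConn, Fin.sum_univ_four, diag, s1, s2, s3, s4, s5, s6] <;> ring

theorem sdCurv_smul (hJ : IsOpen J) (hc : D.IsConnectionForm conn) {q : ℍ}
    (hq : q ∈ cylinder J) (r : Fin 3) (c : ℝ) (v w : ℍ) :
    sdCurv conn r q (c • v) (c • w) = c ^ 2 * sdCurv conn r q v w := by
  have hd : DifferentiableAt ℝ (sdConn conn r) q :=
    (hasFDerivAt_sub_clm (D.differentiableAt_conn hJ hc hq _ _)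
      (D.differentiableAt_conn hJ hc hq _ _)).differentiableAt
  simp only [sdCurv, dOne_apply hd, wedge, map_smul, smul_apply, smul_eq_mul]
  ring

/-- The self-dual block of the curvature in terms of the curvature of the self-dual forms. -/
theorem blockA_eq (hJ : IsOpen J) (hc : D.IsConnectionForm conn) {q : ℍ} (hq : q ∈ cylinder J)
    (r s : Fin 3) :
    2 * D.vol (time q) ^ 2 * D.blockA conn q r s =
      sdCurv conn r q (leftField (D.fr 0) q) (leftField (D.fr s.succ) q) -
      sdCurv conn r q (leftField (D.fr (s + 1).succ) q) (leftField (D.fr (s + 2).succ) q) := by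
  have hv := (D.vol_pos hq.2).ne'
  have e := fun k l => D.sdCurv_smul hJ hc hq r (D.vol (time q))⁻¹ (leftField (D.fr k) q)
    (leftField (D.fr l) q)
  simp only [← D.frame_eq hq] at e
  have h : D.blockA conn q r s = (sdCurv conn r q (D.frame 0 q) (D.frame s.succ q) -
      sdCurv conn r q (D.frame (s + 1).succ q) (D.frame (s + 2).succ q)) / 2 := by
    rw [D.sdCurv_eq hJ hc hq, D.sdCurv_eq hJ hc hq]
    simp only [blockA, curv, Matrix.of_apply]
    ring
  rw [h, e, e]
  field_simp

theorem blockA_eq_zero {q : ℍ} (h1 : D.weylPlus conn q = 0) (h2 : D.scalarCurv conn q = 0) :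
    D.blockA conn q = 0 := by
  simpa [weylPlus, h2] using h1

/-- The evolution equation of the shape matrix of an anti-self-dual scalar-flat metric. -/
theorem deriv_shape (hJ : IsOpen J) (hD : D.IsASDScalarFlat) {t : ℝ} (ht : t ∈ J) (r s : Fin 3) :
    deriv (D.shape r s) t = (∑ m, D.struct s m t * D.shape r m t) + D.ratio s t * D.shape r s t
      - D.rot (r + 1) t * D.shape (r + 2) s t + D.rot (r + 2) t * D.shape (r + 1) s t
      - (D.shape (r + 1) (s + 1) t * D.shape (r + 2) (s + 2) t
        - D.shape (r + 1) (s + 2) t * D.shape (r + 2) (s + 1) t) := by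
  obtain ⟨conn, hc, h⟩ := hD
  set q : ℍ := ((Real.exp t : ℝ) : ℍ)
  have hq : q ∈ cylinder J := coe_exp_mem ht
  have hqt : time q = t := time_coe_exp t
  have hA := D.blockA_eq hJ hc hq r s
  rw [D.blockA_eq_zero (h q hq).1 (h q hq).2] at hA
  have hd : DifferentiableAt ℝ (sdConn conn r) q :=
    (hasFDerivAt_sub_clm (D.differentiableAt_conn hJ hc hq _ _)
      (D.differentiableAt_conn hJ hc hq _ _)).differentiableAt
  have hφ : ∀ i, DifferentiableAt ℝ (fun t => -D.shape r i t) (time q) := fun i =>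
    (D.differentiableAt_shape hJ hq.2 r i).fun_neg
  have d1 := D.dOne_one_vec hJ hq hd (φ₀ := D.rot r) (φ := fun i t => -D.shape r i t)
    (differentiableAt_of_contDiffOn hJ (D.contDiffOn_rot hJ r) hq.2)
    -- Of the two pairs of vectors in `blockA_eq`, only the one containing the radial field produces
    -- a derivative of `shape`; the other gives the `ratio` term. The wedge products supply the
    -- `rot` terms and the cofactors.
    hφ (fun x hx => (D.sdConn_fr hJ hc hx r).1) (fun x hx => (D.sdConn_fr hJ hc hx r).2) s
  have d2 := D.dOne_vec_vec hJ hq hd (φ := fun i t => -D.shape r i t) hφ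
    (fun x hx => (D.sdConn_fr hJ hc hx r).2) s
  have f0 := fun r => (D.sdConn_fr hJ hc hq r).1
  have f1 := fun r => (D.sdConn_fr hJ hc hq r).2
  rw [← D.fr_zero, ← D.fr_succ] at d1
  rw [← D.fr_succ, ← D.fr_succ] at d2
  simp only [sdCurv, d1, d2, wedge, f0, f1, hqt] at hA
  simp only [Matrix.zero_apply, mul_zero, deriv.fun_neg, mul_neg,
    Finset.sum_neg_distrib] at hA
  linarith

/-! ### Invariant Hermitian structures as unit vectors -/

variable {I : ℍ → ℍ →L[ℝ] ℍ}

theorem coframe_mul_left {q p : ℍ} (hq : q ≠ 0) (hp : p ≠ 0) (h : time q = time p) (i : Fin 4)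
    (v : ℍ) : D.coframe i q (q * v) = D.coframe i p (p * v) := by
  refine Fin.cases ?_ (fun i => ?_) i
  · rw [D.coframe_zero_mul hq, D.coframe_zero_mul hp, h]
  · rw [D.coframe_succ_mul hq, D.coframe_succ_mul hp, h]

/-- The components of the self-dual form `Ω` in the invariant frame. -/
def dir (I : ℍ → ℍ →L[ℝ] ℍ) (i : Fin 3) (t : ℝ) : ℝ :=
  (D.vol t)⁻¹ * D.coframe i.succ ((Real.exp t : ℝ) : ℍ)
    (I ((Real.exp t : ℝ) : ℍ) (leftField (D.fr 0) ((Real.exp t : ℝ) : ℍ)))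

/-- Left translation by a unit quaternion carries the base point `exp t` to any point at time `t`
and preserves the frame, the coframe and `I`; so the components of `I` depend on time only. -/
theorem coframe_apply_invariant (hinv : IsInvariant J I) {q : ℍ} (hq : q ∈ cylinder J)
    (i j : Fin 4) :
    D.coframe i q (I q (leftField (D.fr j) q)) =
      D.coframe i ((Real.exp (time q) : ℝ) : ℍ) (I ((Real.exp (time q) : ℝ) : ℍ)
        (leftField (D.fr j) ((Real.exp (time q) : ℝ) : ℍ))) := by
  have hn : 0 < ‖q‖ := norm_pos_iff.2 hq.1
  set s : ℍ := ((Real.exp (time q) : ℝ) : ℍ) with hs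
  have hse : s = ((‖q‖ : ℝ) : ℍ) := by rw [hs, time, Real.exp_log hn]
  have hs' : s ∈ cylinder J := coe_exp_mem hq.2
  have hst : time s = time q := time_coe_exp _
  set p := q * s⁻¹ with hp
  have hps : q = p * s := by rw [hp, inv_mul_cancel_right₀ hs'.1]
  have hpn : ‖p‖ = 1 := by
    rw [hp, norm_mul, norm_inv, hse]
    simp [hn.ne']
  have h1 : leftField (D.fr j) q = p * leftField (D.fr j) s := by
    rw [leftField, leftField, hst, ← mul_assoc, ← hps]
  have h2 : I q (leftField (D.fr j) q) = p * I s (leftField (D.fr j) s) := by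
    rw [h1]
    conv_lhs => rw [hps]
    exact hinv p hpn s hs' _
  obtain ⟨z, hz⟩ : ∃ z, I s (leftField (D.fr j) s) = s * z :=
    ⟨s⁻¹ * I s (leftField (D.fr j) s), by rw [mul_inv_cancel_left₀ hs'.1]⟩
  rw [h2, hz, ← mul_assoc, ← hps]
  exact D.coframe_mul_left hq.1 hs'.1 hst.symm i z

theorem eq_sum_fr {q : ℍ} (hq : q ∈ cylinder J) (v : ℍ) :
    v = (D.vol (time q))⁻¹ • ∑ i, D.coframe i q v • leftField (D.fr i) q := by
  rw [Fin.sum_univ_succ]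
  exact D.eq_sum_coframe hq v

theorem kahlerForm_fr (hI : D.IsHermitian I) {q : ℍ} (hq : q ∈ cylinder J) (i j : Fin 4) :
    D.kahlerForm I q ![leftField (D.fr i) q, leftField (D.fr j) q] =
      D.vol (time q) * D.coframe j q (I q (leftField (D.fr i) q)) := by
  rw [D.kahlerForm_apply hI hq, metric_eq]
  simp [D.coframe_fr hq, mul_comm]

theorem kahlerForm_swap (q v w : ℍ) : D.kahlerForm I q ![v, w] = -D.kahlerForm I q ![w, v] := by
  have := (D.kahlerForm I q).map_swap ![w, v] (i := 0) (j := 1) (by decide)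
  refine Eq.trans ?_ this
  change D.kahlerForm I q _ = D.kahlerForm I q _
  congr 1; funext i; fin_cases i <;> rfl

theorem kahlerForm_smul (q v w : ℍ) (c : ℝ) :
    D.kahlerForm I q ![c • v, c • w] = c ^ 2 * D.kahlerForm I q ![v, w] := by
  have := (D.kahlerForm I q).map_smul_univ (fun _ => c) ![v, w]
  have e : (fun i => c • (![v, w] : Fin 2 → ℍ) i) = ![c • v, c • w] := by
    funext i; fin_cases i <;> rfl
  rw [e] at this
  simpa using this

theorem coframe_one_apply (hinv : IsInvariant J I) {q : ℍ}
    (hq : q ∈ cylinder J) (i : Fin 3) :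
    D.coframe i.succ q (I q (leftField (D.fr 0) q)) = D.vol (time q) * D.dir I i (time q) := by
  rw [D.coframe_apply_invariant hinv hq, dir]
  field_simp [(D.vol_pos hq.2).ne']

theorem kahlerForm_one_vec (hI : D.IsHermitian I) (hinv : IsInvariant J I) {q : ℍ}
    (hq : q ∈ cylinder J) (i : Fin 3) :
    D.kahlerForm I q ![leftField (D.fr 0) q, leftField (D.fr i.succ) q] =
      D.vol (time q) ^ 2 * D.dir I i (time q) := by
  rw [D.kahlerForm_fr hI hq, D.coframe_one_apply hinv hq]
  ring

/-- Self-duality determines the spatial components of `Ω` from the radial ones, so `dir` determines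
all of `I`. -/
theorem kahlerForm_vec_vec (hI : D.IsHermitian I) (hinv : IsInvariant J I) (hor : D.IsOriented I)
    {q : ℍ} (hq : q ∈ cylinder J) (i : Fin 3) :
    D.kahlerForm I q ![leftField (D.fr (i + 1).succ) q, leftField (D.fr (i + 2).succ) q] =
      -(D.vol (time q) ^ 2 * D.dir I i (time q)) := by
  have h := hor q hq i
  have hv := (D.vol_pos hq.2).ne'
  simp only [D.frame_eq hq, kahlerForm_smul] at h
  rw [D.kahlerForm_one_vec hI hinv hq] at h
  field_simp at h
  linarith

theorem coframe_fr_skew (hI : D.IsHermitian I) {q : ℍ} (hq : q ∈ cylinder J) (i j : Fin 4) :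
    D.coframe j q (I q (leftField (D.fr i) q)) = -D.coframe i q (I q (leftField (D.fr j) q)) := by
  have hv := (D.vol_pos hq.2).ne'
  apply mul_left_cancel₀ hv
  rw [← D.kahlerForm_fr hI hq, D.kahlerForm_swap, D.kahlerForm_fr hI hq, mul_neg]

theorem coframe_vec_apply (hI : D.IsHermitian I) (hinv : IsInvariant J I) (hor : D.IsOriented I)
    {q : ℍ} (hq : q ∈ cylinder J) (i : Fin 3) :
    D.coframe (i + 2).succ q (I q (leftField (D.fr (i + 1).succ) q)) =
      -(D.vol (time q) * D.dir I i (time q)) := by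
  have hv := (D.vol_pos hq.2).ne'
  apply mul_left_cancel₀ hv
  rw [← D.kahlerForm_fr hI hq, D.kahlerForm_vec_vec hI hinv hor hq]
  ring

theorem apply_one (hI : D.IsHermitian I) (hinv : IsInvariant J I) {q : ℍ} (hq : q ∈ cylinder J) :
    I q (leftField (D.fr 0) q) = ∑ i, D.dir I i (time q) • leftField (D.fr i.succ) q := by
  have hv := (D.vol_pos hq.2).ne'
  have h0 : D.coframe 0 q (I q (leftField (D.fr 0) q)) = 0 := by
    have := D.coframe_fr_skew hI hq 0 0; linarith
  rw [D.eq_sum_fr hq (I q (leftField (D.fr 0) q)), Fin.sum_univ_succ, h0]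
  simp only [D.coframe_one_apply hinv hq, mul_smul, ← Finset.smul_sum]
  simp [hv]

theorem apply_vec (hI : D.IsHermitian I) (hinv : IsInvariant J I) (hor : D.IsOriented I)
    {q : ℍ} (hq : q ∈ cylinder J) (j : Fin 3) :
    I q (leftField (D.fr j.succ) q) = -D.dir I j (time q) • leftField (D.fr 0) q
      - D.dir I (j + 2) (time q) • leftField (D.fr (j + 1).succ) q
      + D.dir I (j + 1) (time q) • leftField (D.fr (j + 2).succ) q := by
  have hv := (D.vol_pos hq.2).ne'
  have h0 := fun i : Fin 3 => D.coframe_fr_skew hI hq i.succ 0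
  have hd : ∀ i, D.coframe i q (I q (leftField (D.fr i) q)) = 0 := fun i => by
    have := D.coframe_fr_skew hI hq i i; linarith
  have h1 := fun i => D.coframe_vec_apply hI hinv hor hq i
  have h2 := fun i : Fin 3 => D.coframe_fr_skew hI hq (i + 2).succ (i + 1).succ
  simp only [h1] at h2
  simp only [D.coframe_one_apply hinv hq] at h0
  rw [D.eq_sum_fr hq (I q (leftField (D.fr j.succ) q)), inv_smul_eq_iff₀ hv, Fin.sum_univ_succ,
    Fin.sum_univ_three, h0]
  have a0 := h1 0
  have a1 := h1 1
  have a2 := h1 2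
  have b0 := h2 0
  have b1 := h2 1
  have b2 := h2 2
  simp only [Fin.reduceAdd, Fin.reduceSucc, Fin.succ_zero_eq_one, Fin.succ_one_eq_two, neg_neg]
    at a0 a1 a2 b0 b1 b2
  fin_cases j <;> simp [a0, a1, a2, b0, b1, b2, hd] <;> module

theorem sum_dir_sq (hI : D.IsHermitian I) (hinv : IsInvariant J I) {t : ℝ} (ht : t ∈ J) :
    ∑ i, D.dir I i t ^ 2 = 1 := by
  have hq := coe_exp_mem ht
  have hqt := time_coe_exp t
  set q : ℍ := ((Real.exp t : ℝ) : ℍ)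
  have hv := (D.vol_pos ht).ne'
  have h := hI.orthogonal q hq (leftField (D.fr 0) q) (leftField (D.fr 0) q)
  have h0 : D.coframe 0 q (I q (leftField (D.fr 0) q)) = 0 := by
    have := D.coframe_fr_skew hI hq 0 0; linarith
  rw [metric_eq, metric_eq, Fin.sum_univ_succ, h0] at h
  simp only [D.coframe_one_apply hinv hq, D.coframe_fr hq, hqt] at h
  have h' : D.vol t ^ 2 * ∑ i, D.dir I i t ^ 2 = D.vol t ^ 2 * 1 := by
    rw [Finset.mul_sum]
    simp at h
    exact (Finset.sum_congr rfl fun i _ => by ring).trans (h.trans (by ring))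
  exact mul_left_cancel₀ (pow_ne_zero 2 hv) h'

theorem differentiableAt_dir (hJ : IsOpen J) (hI : D.IsHermitian I) {t : ℝ} (ht : t ∈ J)
    (i : Fin 3) : DifferentiableAt ℝ (D.dir I i) t := by
  have hq := coe_exp_mem ht
  have hI' : DifferentiableAt ℝ I ((Real.exp t : ℝ) : ℍ) :=
    (hI.smooth.contDiffAt ((isOpen_cylinder hJ).mem_nhds hq)).differentiableAt (by simp)
  have he : DifferentiableAt ℝ (fun s : ℝ => ((Real.exp s : ℝ) : ℍ)) t := by
    have : (fun s : ℝ => ((Real.exp s : ℝ) : ℍ)) = fun s => Real.exp s • (1 : ℍ) := by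
      funext s; ext <;> simp
    rw [this]
    exact Real.differentiableAt_exp.smul_const 1
  have h1 : DifferentiableAt ℝ (fun s : ℝ => I ((Real.exp s : ℝ) : ℍ) 1) t :=
    (hI'.comp t he).clm_apply (differentiableAt_const 1)
  have hd : ∀ {f : ℝ → ℝ}, ContDiffOn ℝ ∞ f J → DifferentiableAt ℝ f t :=
    fun hf => differentiableAt_of_contDiffOn hJ hf ht
  -- On the ray `exp s` the radial field is a real multiple of `1`; by linearity of `I` the factor
  -- `exp s` moves outside, leaving an expression that is differentiable in `s`.
  have e : ∀ s, D.dir I i s = (D.vol s)⁻¹ * (-2 * D.a i s *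
      ∑ l, D.R s i l * imComp l (I ((Real.exp s : ℝ) : ℍ) 1)) := by
    intro s
    have h2 : leftField (D.fr 0) ((Real.exp s : ℝ) : ℍ) = Real.exp s • (1 : ℍ) := by
      simp [leftField, fr_zero]; ext <;> simp
    have h3 : ∀ z : ℍ, Real.exp s • z = ((Real.exp s : ℝ) : ℍ) * z := by
      intro z; rw [Quaternion.coe_mul_eq_smul]
    rw [dir, h2, map_smul, h3, D.coframe_succ_mul (fun h => (Real.exp_pos s).ne'
      (congrArg QuaternionAlgebra.re h)), time_coe_exp]
  rw [show D.dir I i = _ from funext e]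
  refine ((hd D.contDiffOn_vol).inv (D.vol_pos ht).ne').mul
    (((differentiableAt_const _).mul (hd (D.a_smooth i))).mul ?_)
  exact DifferentiableAt.fun_sum fun l _ => (hd (D.R_smooth i l)).mul
    ((imComp l).differentiableAt.comp t h1)

/-! ### Brackets and the Nijenhuis tensor in components -/

/-- The generator with components `c` in the invariant frame. -/
def lin (c : Fin 4 → ℝ → ℝ) (t : ℝ) : ℍ := ∑ i, c i t • D.fr i t

theorem leftField_lin (c : Fin 4 → ℝ → ℝ) (q : ℍ) :
    leftField (D.lin c) q = ∑ i, c i (time q) • leftField (D.fr i) q := by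
  simp [leftField, lin, Finset.mul_sum]

theorem coframe_lin {q : ℍ} (hq : q ∈ cylinder J) (c : Fin 4 → ℝ → ℝ) (i : Fin 4) :
    D.coframe i q (leftField (D.lin c) q) = D.vol (time q) * c i (time q) := by
  rw [leftField_lin]
  simp [D.coframe_fr hq, mul_comm]

theorem lin_eq (c : Fin 4 → ℝ → ℝ) (t : ℝ) :
    D.lin c t = c 0 t • (1 : ℍ) + ∑ i : Fin 3, c i.succ t • D.vec i t := by
  rw [lin, Fin.sum_univ_succ]; rfl

theorem leftField_lin_succ (c : Fin 4 → ℝ → ℝ) (q : ℍ) :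
    leftField (D.lin c) q = c 0 (time q) • leftField (D.fr 0) q +
      ∑ i : Fin 3, c i.succ (time q) • leftField (D.fr i.succ) q := by
  rw [leftField_lin, Fin.sum_univ_succ]

/-- The bracket in components with respect to the invariant frame. -/
def bracketCoeff (c d : Fin 4 → ℝ → ℝ) : Fin 4 → ℝ → ℝ :=
  Fin.cons (fun t => c 0 t * deriv (d 0) t - d 0 t * deriv (c 0) t) fun k t =>
    c 0 t * (deriv (d k.succ) t + ∑ i : Fin 3, d i.succ t * D.struct i k t)
      - d 0 t * (deriv (c k.succ) t + ∑ i : Fin 3, c i.succ t * D.struct i k t)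
      - D.ratio k t * (c (k + 1).succ t * d (k + 2).succ t - c (k + 2).succ t * d (k + 1).succ t)

theorem hasDerivAt_lin (hJ : IsOpen J) {t : ℝ} (ht : t ∈ J) {c : Fin 4 → ℝ → ℝ}
    (hc : ∀ i, DifferentiableAt ℝ (c i) t) :
    HasDerivAt (D.lin c) (deriv (c 0) t • (1 : ℍ) + ∑ i : Fin 3,
      (deriv (c i.succ) t • D.vec i t + c i.succ t • ∑ m, D.struct i m t • D.vec m t)) t := by
  have h1 : HasDerivAt (fun s => c 0 s • (1 : ℍ)) (deriv (c 0) t • 1) t :=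
    (hc 0).hasDerivAt.smul_const 1
  have h2 : ∀ i ∈ (Finset.univ : Finset (Fin 3)), HasDerivAt (fun s => c i.succ s • D.vec i s)
      (deriv (c i.succ) t • D.vec i t + c i.succ t • ∑ m, D.struct i m t • D.vec m t) t := by
    intro i _
    rw [← D.deriv_vec hJ ht, add_comm]
    exact (hc i.succ).hasDerivAt.smul (D.differentiableAt_vec hJ ht i).hasDerivAt
  rw [show D.lin c = _ from funext (D.lin_eq c)]
  exact h1.add (HasDerivAt.fun_sum h2)

theorem lin_re (c : Fin 4 → ℝ → ℝ) (t : ℝ) : (D.lin c t).re = c 0 t := by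
  simp [lin_eq, Fin.sum_univ_three, vec_re]

/-- Invariant fields are closed under brackets, which turns the Nijenhuis tensor into algebra in the
coefficients and their time derivatives. -/
theorem leftBracket_lin (hJ : IsOpen J) {t : ℝ} (ht : t ∈ J) {c d : Fin 4 → ℝ → ℝ}
    (hc : ∀ i, DifferentiableAt ℝ (c i) t) (hd : ∀ i, DifferentiableAt ℝ (d i) t) :
    leftBracket (D.lin c) (D.lin d) t = D.lin (D.bracketCoeff c d) t := by
  rw [leftBracket, (D.hasDerivAt_lin hJ ht hc).deriv, (D.hasDerivAt_lin hJ ht hd).deriv, lin_re,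
    lin_re, lin_eq, lin_eq, lin_eq]
  have c0 := sub_eq_iff_eq_add.1 (D.vec_comm ht 0)
  have c1 := sub_eq_iff_eq_add.1 (D.vec_comm ht 1)
  have c2 := sub_eq_iff_eq_add.1 (D.vec_comm ht 2)
  simp only [Fin.reduceAdd] at c0 c1 c2
  simp only [Fin.sum_univ_three, bracketCoeff, Fin.cons_zero, Fin.cons_succ, ratio, Fin.reduceAdd,
    mul_add, add_mul, smul_mul_assoc, mul_smul_comm, c0, c1, c2, mul_one, one_mul]
  module

/-- The almost complex structure in components with respect to the invariant frame. -/
def rotCoeff (x : Fin 3 → ℝ → ℝ) (c : Fin 4 → ℝ → ℝ) : Fin 4 → ℝ → ℝ :=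
  Fin.cons (fun t => -∑ i : Fin 3, x i t * c i.succ t) fun k t =>
    c 0 t * x k t - (x (k + 1) t * c (k + 2).succ t - x (k + 2) t * c (k + 1).succ t)

theorem apply_lin (hI : D.IsHermitian I) (hinv : IsInvariant J I) (hor : D.IsOriented I)
    {q : ℍ} (hq : q ∈ cylinder J) (c : Fin 4 → ℝ → ℝ) :
    I q (leftField (D.lin c) q) = leftField (D.lin (rotCoeff (D.dir I) c)) q := by
  rw [leftField_lin_succ, leftField_lin_succ, map_add, map_sum]
  simp only [map_smul, D.apply_one hI hinv hq, D.apply_vec hI hinv hor hq, Fin.sum_univ_three,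
    rotCoeff, Fin.cons_zero, Fin.cons_succ, Fin.reduceAdd]
  module

theorem differentiableAt_rotCoeff {x : Fin 3 → ℝ → ℝ} {c : Fin 4 → ℝ → ℝ} {t : ℝ}
    (hx : ∀ i, DifferentiableAt ℝ (x i) t) (hc : ∀ i, DifferentiableAt ℝ (c i) t) (i : Fin 4) :
    DifferentiableAt ℝ (rotCoeff x c i) t := by
  refine Fin.cases ?_ (fun i => ?_) i
  · exact (DifferentiableAt.fun_sum fun i _ => (hx i).mul (hc i.succ)).fun_neg
  · exact ((hc _).mul (hx _)).sub (((hx _).mul (hc _)).sub ((hx _).mul (hc _)))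

theorem lieBracket_lin (hJ : IsOpen J) {q : ℍ} (hq : q ∈ cylinder J) {c d : Fin 4 → ℝ → ℝ}
    (hc : ∀ i, DifferentiableAt ℝ (c i) (time q)) (hd : ∀ i, DifferentiableAt ℝ (d i) (time q)) :
    VectorField.lieBracket ℝ (leftField (D.lin c)) (leftField (D.lin d)) q =
      leftField (D.lin (D.bracketCoeff c d)) q := by
  rw [lieBracket_leftField hq.1 (D.hasDerivAt_lin hJ hq.2 hc).differentiableAt
    (D.hasDerivAt_lin hJ hq.2 hd).differentiableAt, leftField, leftField,
    D.leftBracket_lin hJ hq.2 hc hd]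

theorem contDiffOn_lin_const (c : Fin 4 → ℝ) :
    ContDiffOn ℝ ∞ (leftField (D.lin fun i _ => c i)) (cylinder J) := by
  refine contDiffOn_leftField ?_
  rw [show D.lin (fun i _ => c i) = _ from funext (D.lin_eq _)]
  exact contDiffOn_const.add (ContDiffOn.sum fun i _ =>
    ContDiffOn.fun_smul contDiffOn_const (D.contDiffOn_vec i))

/-- The vanishing of the Nijenhuis tensor in components with respect to the invariant frame. -/
theorem nijenhuis_coeff (hJ : IsOpen J) (hI : D.IsHermitian I) (hinv : IsInvariant J I)
    (hor : D.IsOriented I) {t : ℝ} (ht : t ∈ J) (c d : Fin 4 → ℝ) (k : Fin 4) :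
    D.bracketCoeff (rotCoeff (D.dir I) fun i _ => c i) (rotCoeff (D.dir I) fun i _ => d i) k t
      - rotCoeff (D.dir I) (D.bracketCoeff (rotCoeff (D.dir I) fun i _ => c i) fun i _ => d i) k t
      - rotCoeff (D.dir I) (D.bracketCoeff (fun i _ => c i) (rotCoeff (D.dir I) fun i _ => d i)) k t
      - D.bracketCoeff (fun i _ => c i) (fun i _ => d i) k t = 0 := by
  have hq := coe_exp_mem ht
  have hqt := time_coe_exp t
  set q : ℍ := ((Real.exp t : ℝ) : ℍ)
  have hn := eventually_mem hJ hq
  have hx : ∀ i, DifferentiableAt ℝ (D.dir I i) (time q) :=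
    fun i => D.differentiableAt_dir hJ hI hq.2 i
  have hcd : ∀ c : Fin 4 → ℝ, ∀ i, DifferentiableAt ℝ (fun _ : ℝ => c i) (time q) :=
    fun c i => differentiableAt_const _
  have hr := fun c : Fin 4 → ℝ => differentiableAt_rotCoeff hx (hcd c)
  -- The component formula for `I` holds only on the cylinder; this is enough, since a bracket at
  -- `q` depends only on germs at `q`.
  have e : ∀ c : Fin 4 → ℝ, (fun x => I x (leftField (D.lin fun i _ => c i) x)) =ᶠ[nhds q]
      leftField (D.lin (rotCoeff (D.dir I) fun i _ => c i)) := fun c => by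
    filter_upwards [hn] with x hx using D.apply_lin hI hinv hor hx _
  have h := hI.integrable _ _ (D.contDiffOn_lin_const c) (D.contDiffOn_lin_const d) q hq
  rw [(e c).lieBracket_vectorField_eq (e d),
    (e c).lieBracket_vectorField_eq Filter.EventuallyEq.rfl,
    Filter.EventuallyEq.lieBracket_vectorField_eq Filter.EventuallyEq.rfl (e d),
    D.lieBracket_lin hJ hq (hr c) (hr d), D.lieBracket_lin hJ hq (hr c) (hcd d),
    D.lieBracket_lin hJ hq (hcd c) (hr d), D.lieBracket_lin hJ hq (hcd c) (hcd d),
    D.apply_lin hI hinv hor hq, D.apply_lin hI hinv hor hq] at h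
  have h1 := congrArg (D.coframe k q) h
  simp only [map_sub, D.coframe_lin hq, map_zero, ← mul_sub, hqt] at h1
  exact (mul_eq_zero.1 h1).resolve_left (D.vol_pos ht).ne'

theorem rotCoeff_zero (x : Fin 3 → ℝ → ℝ) (c : Fin 4 → ℝ → ℝ) (t : ℝ) :
    rotCoeff x c 0 t = -∑ i : Fin 3, x i t * c i.succ t := rfl

theorem rotCoeff_succ (x : Fin 3 → ℝ → ℝ) (c : Fin 4 → ℝ → ℝ) (k : Fin 3) (t : ℝ) :
    rotCoeff x c k.succ t = c 0 t * x k t -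
      (x (k + 1) t * c (k + 2).succ t - x (k + 2) t * c (k + 1).succ t) := rfl

theorem bracketCoeff_zero (c d : Fin 4 → ℝ → ℝ) (t : ℝ) :
    D.bracketCoeff c d 0 t = c 0 t * deriv (d 0) t - d 0 t * deriv (c 0) t := rfl

theorem bracketCoeff_succ (c d : Fin 4 → ℝ → ℝ) (k : Fin 3) (t : ℝ) :
    D.bracketCoeff c d k.succ t =
      c 0 t * (deriv (d k.succ) t + ∑ i : Fin 3, d i.succ t * D.struct i k t)
      - d 0 t * (deriv (c k.succ) t + ∑ i : Fin 3, c i.succ t * D.struct i k t)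
      - D.ratio k t *
        (c (k + 1).succ t * d (k + 2).succ t - c (k + 2).succ t * d (k + 1).succ t) := rfl

theorem deriv_rotCoeff {x : Fin 3 → ℝ → ℝ} {t : ℝ} (hx : ∀ i, DifferentiableAt ℝ (x i) t)
    (c : Fin 4 → ℝ) (k : Fin 4) :
    deriv (rotCoeff x (fun i _ => c i) k) t =
      rotCoeff (fun i => deriv (x i)) (fun i _ => c i) k t := by
  refine Fin.cases ?_ (fun k => ?_) k
  · exact (HasDerivAt.fun_sum fun i _ => (hx i).hasDerivAt.mul_const (c i.succ)).fun_neg.deriv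
  · exact (((hx k).hasDerivAt.const_mul (c 0)).sub (((hx (k + 1)).hasDerivAt.mul_const _).sub
      ((hx (k + 2)).hasDerivAt.mul_const _))).deriv

/-- The image of the direction under the shape matrix. -/
def shapeDir (I : ℍ → ℍ →L[ℝ] ℍ) (i : Fin 3) (t : ℝ) : ℝ := ∑ j, D.shape i j t * D.dir I j t

/-- The value of the shape matrix on the direction. -/
def shapeQuad (I : ℍ → ℍ →L[ℝ] ℍ) (t : ℝ) : ℝ := ∑ i, D.dir I i t * D.shapeDir I i t

/-- The trace of the shape matrix. -/
def shapeTrace (t : ℝ) : ℝ := ∑ i, D.alpha i t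

theorem sum_dir_mul_deriv (hJ : IsOpen J) (hI : D.IsHermitian I) (hinv : IsInvariant J I) {t : ℝ}
    (ht : t ∈ J) : ∑ i, D.dir I i t * deriv (D.dir I i) t = 0 := by
  have h1 := HasDerivAt.fun_sum (u := Finset.univ) fun i (_ : i ∈ Finset.univ) =>
    (D.differentiableAt_dir hJ hI ht i).hasDerivAt.pow 2
  have h2 : (fun s => ∑ i, (D.dir I i ^ 2) s) =ᶠ[nhds t] fun _ => 1 := by
    filter_upwards [hJ.mem_nhds ht] with s hs using D.sum_dir_sq hI hinv hs
  have h3 := (h1.congr_of_eventuallyEq h2.symm).unique (hasDerivAt_const t _)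
  simp only [Fin.sum_univ_three] at h3 ⊢
  norm_num at h3
  linarith

/-- The first derivative of the direction, from the vanishing of the Nijenhuis tensor. -/
theorem deriv_dir (hJ : IsOpen J) (hI : D.IsHermitian I) (hinv : IsInvariant J I)
    (hor : D.IsOriented I) {t : ℝ} (ht : t ∈ J) (i : Fin 3) :
    deriv (D.dir I i) t = D.rot (i + 2) t * D.dir I (i + 1) t - D.rot (i + 1) t * D.dir I (i + 2) t
      - D.shapeDir I i t + D.shapeQuad I t * D.dir I i t := by
  -- The Nijenhuis tensor on the radial field and the `j`-th spatial field; its radial component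
  -- involves `x'` only through a cross product with `x`.
  have N := fun j => D.nijenhuis_coeff hJ hI hinv hor ht (Fin.cons 1 0)
    (Fin.cons 0 (Pi.single j 1)) 0
  have n0 := N 0
  have n1 := N 1
  have n2 := N 2
  have hx := fun i => D.differentiableAt_dir hJ hI ht i
  have s0 := D.struct_self hJ ht 0
  have s1 := D.struct_self hJ ht 1
  have s2 := D.struct_self hJ ht 2
  have c0 := D.struct_cyc 0 t
  have c1 := D.struct_cyc 1 t
  have c2 := D.struct_cyc 2 t
  have d0 := D.struct_cyc' 0 t
  have d1 := D.struct_cyc' 1 t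
  have d2 := D.struct_cyc' 2 t
  simp only [Fin.reduceAdd] at s0 s1 s2 c0 c1 c2 d0 d1 d2
  simp only [rotCoeff_zero, rotCoeff_succ, bracketCoeff_zero, bracketCoeff_succ,
    deriv_rotCoeff hx, Fin.sum_univ_three, Fin.reduceAdd, Fin.cons_zero, Fin.cons_succ,
    deriv_const, s0, s1, s2, c0, c1, c2, d0, d1, d2, Pi.zero_apply] at n0 n1 n2
  simp at n0 n1 n2
  have h1 := D.sum_dir_sq hI hinv ht
  have h2 := D.sum_dir_mul_deriv hJ hI hinv ht
  simp only [Fin.sum_univ_three] at h1 h2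
  have e0 := D.shape_symm 1 0 t
  have e1 := D.shape_symm 2 1 t
  have e2 := D.shape_symm 0 2 t
  -- The equations `n` say, up to sign, that `x × (x' - x × rot + Sx) = 0`. Crossing with `x` and
  -- using `|x| = 1` and `x·x' = 0` solves for `x'`.
  fin_cases i <;>
    simp only [shapeQuad, shapeDir, Fin.sum_univ_three, shape_self, e0, e1, e2, Fin.reduceAdd,
      Fin.zero_eta, Fin.mk_one, Fin.reduceFinMk, zero_add]
  · linear_combination D.dir I 1 t * n2 - D.dir I 2 t * n1 - (deriv (D.dir I 0) t
      - (D.rot 2 t * D.dir I 1 t - D.rot 1 t * D.dir I 2 t) + (D.alpha 0 t * D.dir I 0 t +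
        D.shape 0 1 t * D.dir I 1 t + D.shape 2 0 t * D.dir I 2 t)) * h1 + D.dir I 0 t * h2
  · linear_combination D.dir I 2 t * n0 - D.dir I 0 t * n2 - (deriv (D.dir I 1) t
      - (D.rot 0 t * D.dir I 2 t - D.rot 2 t * D.dir I 0 t) + (D.shape 0 1 t * D.dir I 0 t +
        D.alpha 1 t * D.dir I 1 t + D.shape 1 2 t * D.dir I 2 t)) * h1 + D.dir I 1 t * h2
  · linear_combination D.dir I 0 t * n1 - D.dir I 1 t * n0 - (deriv (D.dir I 2) t
      - (D.rot 1 t * D.dir I 0 t - D.rot 0 t * D.dir I 1 t) + (D.shape 2 0 t * D.dir I 0 t +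
        D.shape 1 2 t * D.dir I 1 t + D.alpha 2 t * D.dir I 2 t)) * h1 + D.dir I 2 t * h2

/-- The shape matrix is a multiple of the identity on the orthogonal complement of the
direction. -/
theorem shape_eq (hJ : IsOpen J) (hI : D.IsHermitian I) (hinv : IsInvariant J I)
    (hor : D.IsOriented I) {t : ℝ} (ht : t ∈ J) (i j : Fin 3) :
    2 * D.shape i j t = (D.shapeTrace t - D.shapeQuad I t) *
        ((if i = j then 1 else 0) - D.dir I i t * D.dir I j t)
      + 2 * D.dir I i t * D.shapeDir I j t + 2 * D.shapeDir I i t * D.dir I j t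
      - 2 * D.shapeQuad I t * D.dir I i t * D.dir I j t := by
  have F := D.deriv_dir hJ hI hinv hor ht
  -- The same pairs of fields as in `deriv_dir`, now with spatial components. Six of the nine
  -- suffice because `S` is symmetric; `deriv_dir` then eliminates `x'`.
  have N := fun j k => D.nijenhuis_coeff hJ hI hinv hor ht (Fin.cons 1 0)
    (Fin.cons 0 (Pi.single j 1)) (Fin.succ k)
  have n00 := N 0 0
  have n11 := N 1 1
  have n22 := N 2 2
  have n01 := N 1 0
  have n12 := N 2 1
  have n20 := N 0 2
  have hx := fun i => D.differentiableAt_dir hJ hI ht i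
  have s0 := D.struct_self hJ ht 0
  have s1 := D.struct_self hJ ht 1
  have s2 := D.struct_self hJ ht 2
  have c0 := D.struct_cyc 0 t
  have c1 := D.struct_cyc 1 t
  have c2 := D.struct_cyc 2 t
  have d0 := D.struct_cyc' 0 t
  have d1 := D.struct_cyc' 1 t
  have d2 := D.struct_cyc' 2 t
  have f0 := F 0
  have f1 := F 1
  have f2 := F 2
  have e0 := D.shape_symm 1 0 t
  have e1 := D.shape_symm 2 1 t
  have e2 := D.shape_symm 0 2 t
  simp only [Fin.reduceAdd] at s0 s1 s2 c0 c1 c2 d0 d1 d2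
  simp only [rotCoeff_zero, rotCoeff_succ, bracketCoeff_zero, bracketCoeff_succ,
    deriv_rotCoeff hx, Fin.sum_univ_three, Fin.reduceAdd, Fin.cons_zero, Fin.cons_succ,
    deriv_const, s0, s1, s2, c0, c1, c2, d0, d1, d2, Pi.zero_apply] at n00 n11 n22 n01 n12 n20
  simp at n00 n11 n22 n01 n12 n20
  have h1 := D.sum_dir_sq hI hinv ht
  have h2 := D.sum_dir_mul_deriv hJ hI hinv ht
  simp only [shapeQuad, shapeDir, Fin.sum_univ_three, shape_self, e0, e1, e2, Fin.reduceAdd,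
    zero_add] at h1 h2 f0 f1 f2
  fin_cases i <;> fin_cases j <;>
    simp only [shapeQuad, shapeDir, shapeTrace, Fin.sum_univ_three, shape_self, e0, e1, e2,
      Fin.zero_eta, Fin.mk_one, Fin.reduceFinMk, if_true, Fin.reduceEq, if_false, zero_ne_one,
      one_ne_zero]
  · linear_combination n00 - D.dir I 0 t * f0 - (D.alpha 0 t - D.ratio 0 t) * h1 - h2
  · linear_combination n01 - D.dir I 0 t * f1 - (D.shape 0 1 t - D.rot 2 t) * h1
  · linear_combination n20 - D.dir I 2 t * f0 - (D.shape 2 0 t - D.rot 1 t) * h1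
  · linear_combination n01 - D.dir I 0 t * f1 - (D.shape 0 1 t - D.rot 2 t) * h1
  · linear_combination n11 - D.dir I 1 t * f1 - (D.alpha 1 t - D.ratio 1 t) * h1 - h2
  · linear_combination n12 - D.dir I 1 t * f2 - (D.shape 1 2 t - D.rot 0 t) * h1
  · linear_combination n20 - D.dir I 2 t * f0 - (D.shape 2 0 t - D.rot 1 t) * h1
  · linear_combination n12 - D.dir I 1 t * f2 - (D.shape 1 2 t - D.rot 0 t) * h1
  · linear_combination n22 - D.dir I 2 t * f2 - (D.alpha 2 t - D.ratio 2 t) * h1 - h2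

end InvariantMetric

/-! ### The exterior derivative of the Kähler form -/

theorem differentiableAt_skewForm {E : Type*} [NormedAddCommGroup E] [NormedSpace ℝ E]
    {g : E → E →L[ℝ] E →L[ℝ] ℝ} {I : E → E →L[ℝ] E} {q : E} (hg : DifferentiableAt ℝ g q)
    (hI : DifferentiableAt ℝ I q) :
    DifferentiableAt ℝ (fun q => (1 / 2 : ℝ) • ContinuousAlternatingMap.alternatizeUncurryFin
      ((ContinuousAlternatingMap.ofSubsingletonLIE (𝕜 := ℝ) (E := E) (F := ℝ)
        (0 : Fin 1)).toContinuousLinearEquiv.toContinuousLinearMap.comp ((g q).comp (I q)))) q := by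
  have h1 : DifferentiableAt ℝ (fun q => (ContinuousAlternatingMap.ofSubsingletonLIE (𝕜 := ℝ)
      (E := E) (F := ℝ) (0 : Fin 1)).toContinuousLinearEquiv.toContinuousLinearMap.comp
        ((g q).comp (I q))) q :=
    (differentiableAt_const _).clm_comp (hg.clm_comp hI)
  exact ((ContinuousAlternatingMap.alternatizeUncurryFinCLM ℝ E ℝ).differentiableAt.comp q
    h1).const_smul (1 / 2 : ℝ)

theorem differentiableAt_smul_bilinear {E F G H : Type*} [NormedAddCommGroup E] [NormedSpace ℝ E]
    [NormedAddCommGroup F] [NormedSpace ℝ F] [NormedAddCommGroup G] [NormedSpace ℝ G]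
    [NormedAddCommGroup H] [NormedSpace ℝ H] (L : F →L[ℝ] G →L[ℝ] H) {c : E → ℝ} {f : E → F}
    {g : E → G} {q : E} (hc : DifferentiableAt ℝ c q) (hf : DifferentiableAt ℝ f q)
    (hg : DifferentiableAt ℝ g q) : DifferentiableAt ℝ (fun x => c x • L (f x) (g x)) q :=
  hc.smul ((L.differentiableAt.comp q hf).clm_apply hg)

theorem differentiableAt_add_sum {E F H ι : Type*} [Fintype ι] [NormedAddCommGroup E]
    [NormedSpace ℝ E] [NormedAddCommGroup F] [NormedSpace ℝ F] [NormedAddCommGroup H]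
    [NormedSpace ℝ H] (L : F →L[ℝ] F →L[ℝ] H) {c : E → ℝ} {f : E → F} {d : ι → E → ℝ}
    {g : ι → E → F} {q : E} (hc : DifferentiableAt ℝ c q) (hf : DifferentiableAt ℝ f q)
    (hd : ∀ i, DifferentiableAt ℝ (d i) q) (hg : ∀ i, DifferentiableAt ℝ (g i) q) :
    DifferentiableAt ℝ (fun x => c x • L (f x) (f x) + ∑ i, d i x • L (g i x) (g i x)) q :=
  (differentiableAt_smul_bilinear L hc hf hf).fun_add
    (DifferentiableAt.fun_sum fun i _ => differentiableAt_smul_bilinear L (hd i) (hg i) (hg i))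

theorem differentiableAt_sum_smulRight {E ι : Type*} [Fintype ι] [NormedAddCommGroup E]
    [NormedSpace ℝ E] {c : E → ℝ} {f : E → E →L[ℝ] ℝ} {d : ι → E → ℝ}
    {g : ι → E → E →L[ℝ] ℝ} {q : E} (hc : DifferentiableAt ℝ c q) (hf : DifferentiableAt ℝ f q)
    (hd : ∀ i, DifferentiableAt ℝ (d i) q) (hg : ∀ i, DifferentiableAt ℝ (g i) q) :
    DifferentiableAt ℝ (fun x => c x • (f x).smulRight (f x) +
      ∑ i, d i x • (g i x).smulRight (g i x)) q := by
  have := differentiableAt_add_sum (F := E →L[ℝ] ℝ) (H := E →L[ℝ] E →L[ℝ] ℝ)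
    (ContinuousLinearMap.smulRightL ℝ E (E →L[ℝ] ℝ)) hc hf hd hg
  exact this

namespace InvariantMetric

variable {J : Set ℝ} (D : InvariantMetric J) {I : ℍ → ℍ →L[ℝ] ℍ}

theorem differentiableAt_kahlerForm (hJ : IsOpen J) (hI : D.IsHermitian I) {q : ℍ}
    (hq : q ∈ cylinder J) : DifferentiableAt ℝ (D.kahlerForm I) q := by
  have hI' : DifferentiableAt ℝ I q :=
    (hI.smooth.contDiffAt ((isOpen_cylinder hJ).mem_nhds hq)).differentiableAt (by simp)
  have ht := differentiableAt_time hq.1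
  have hc : ∀ {f : ℝ → ℝ}, ContDiffOn ℝ ∞ f J →
      DifferentiableAt ℝ (fun x => (f (time x)) ^ 2) q :=
    fun hf => ((differentiableAt_of_contDiffOn hJ hf hq.2).comp q ht).pow 2
  have hs : ∀ i, DifferentiableAt ℝ (D.sigmaTilde i) q := fun i =>
    differentiableAt_sum_clm fun l => differentiableAt_smul_clm
      ((differentiableAt_of_contDiffOn hJ (D.R_smooth i l) hq.2).comp q ht)
      (differentiableAt_sigma hq.1 l)
  exact differentiableAt_skewForm (differentiableAt_sum_smulRight (hc D.contDiffOn_vol)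
    (differentiableAt_dt hq.1) (fun i => hc (D.a_smooth i)) hs) hI'

theorem kahlerForm_sum (hI : D.IsHermitian I) {q : ℍ} (hq : q ∈ cylinder J) {v : ℝ → ℍ}
    {c : Fin 3 → ℝ} (h : v (time q) = ∑ m, c m • D.vec m (time q)) (w : ℍ) :
    D.kahlerForm I q ![leftField v q, w] =
      ∑ m, c m * D.kahlerForm I q ![leftField (D.fr m.succ) q, w] := by
  simp only [D.kahlerForm_apply hI hq, fr_succ]
  simp [leftField, h, Finset.mul_sum]

theorem kahlerForm_self (q v : ℍ) : D.kahlerForm I q ![v, v] = 0 := by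
  have := D.kahlerForm_swap (I := I) q v v; linarith

/-- The components of `Ω` are constant along `SU(2)`, and each bracket of two spatial fields is a
multiple of the third, on which it is paired with itself. -/
theorem extDeriv_kahlerForm_vec (hJ : IsOpen J) (hI : D.IsHermitian I) (hinv : IsInvariant J I)
    (hor : D.IsOriented I) {q : ℍ} (hq : q ∈ cylinder J) :
    extDeriv (D.kahlerForm I) q (fun i => leftField (D.fr i.succ) q) = 0 := by
  have hn := eventually_mem hJ hq
  have hv := D.differentiableAt_vol hJ hq.2
  have hx := fun i => D.differentiableAt_dir hJ hI hq.2 i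
  have K := fun (x : ℍ) (hx : x ∈ cylinder J) i => D.kahlerForm_vec_vec hI hinv hor hx i
  rw [extDeriv_leftField (v := fun i => D.fr i.succ)
    (φ := fun i t => -(D.vol t ^ 2 * D.dir I i t)) hq.1
    (D.differentiableAt_kahlerForm hJ hI hq) (fun i => D.differentiableAt_vec hJ hq.2 i)
    (fun i => ((hv.pow 2).mul (hx i)).fun_neg)
    (hn.mono fun x hx => K x hx 0) (hn.mono fun x hx => K x hx 1)
    (hn.mono fun x hx => K x hx 2)]
  have B : ∀ i : Fin 3, D.kahlerForm I q
      ![leftField (leftBracket (D.fr i.succ) (D.fr (i + 1).succ)) q,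
        leftField (D.fr (i + 2).succ) q] = 0 := by
    intro i
    have hb := D.leftBracket_vec_vec hq.2 i
    rw [D.kahlerForm_apply hI hq, leftField, fr_succ, fr_succ, hb, mul_smul_comm, map_smul,
      map_smul, smul_apply]
    have := D.kahlerForm_apply hI hq (leftField (D.fr (i + 2).succ) q)
      (leftField (D.fr (i + 2).succ) q)
    rw [kahlerForm_self] at this
    rw [fr_succ] at this ⊢
    rw [leftField] at this ⊢
    rw [← this, smul_zero]
  have b0 := B 0
  have b1 := B 1
  have b2 := B 2
  simp only [Fin.reduceAdd] at b0 b1 b2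
  rw [b0, b1, b2]
  simp [fr_succ, vec_re]

theorem extDeriv_kahlerForm_one (hJ : IsOpen J) (hI : D.IsHermitian I) (hinv : IsInvariant J I)
    (hor : D.IsOriented I) {q : ℍ} (hq : q ∈ cylinder J) (i : Fin 3) :
    extDeriv (D.kahlerForm I) q ![leftField (D.fr 0) q, leftField (D.fr (i + 1).succ) q,
      leftField (D.fr (i + 2).succ) q] = D.vol (time q) ^ 2 *
        (2 * D.shapeDir I i (time q) -
          (D.shapeTrace (time q) + D.shapeQuad I (time q)) * D.dir I i (time q)) := by
  have hn := eventually_mem hJ hq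
  have hv := D.differentiableAt_vol hJ hq.2
  have hx := fun i => D.differentiableAt_dir hJ hI hq.2 i
  have K := fun (x : ℍ) (hx : x ∈ cylinder J) i => D.kahlerForm_vec_vec hI hinv hor hx i
  have K0 := fun (x : ℍ) (hx : x ∈ cylinder J) i => D.kahlerForm_one_vec hI hinv hx i
  have e := extDeriv_leftField (v := ![D.fr 0, D.fr (i + 1).succ, D.fr (i + 2).succ])
    (φ := ![fun t => -(D.vol t ^ 2 * D.dir I i t), fun t => -(D.vol t ^ 2 * D.dir I (i + 2) t),
      fun t => D.vol t ^ 2 * D.dir I (i + 1) t]) hq.1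
    (D.differentiableAt_kahlerForm hJ hI hq)
    (by
      intro k; fin_cases k
      · exact differentiableAt_const _
      · exact D.differentiableAt_vec hJ hq.2 _
      · exact D.differentiableAt_vec hJ hq.2 _)
    (by
      intro k; fin_cases k
      · exact ((hv.pow 2).mul (hx _)).fun_neg
      · exact ((hv.pow 2).mul (hx _)).fun_neg
      · exact (hv.pow 2).mul (hx _))
    (hn.mono fun x hx => K x hx i)
    (hn.mono fun x hx => (D.kahlerForm_swap _ _ _).trans (by
      rw [Matrix.cons_val_zero, Matrix.cons_val_two, Matrix.cons_val_one]
      exact congrArg _ (K0 x hx (i + 2))))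
    (hn.mono fun x hx => K0 x hx (i + 1))
  have e0 : (fun k => leftField ((![D.fr 0, D.fr (i + 1).succ, D.fr (i + 2).succ] :
      Fin 3 → ℝ → ℍ) k) q) = ![leftField (D.fr 0) q, leftField (D.fr (i + 1).succ) q,
        leftField (D.fr (i + 2).succ) q] := by funext k; fin_cases k <;> rfl
  rw [e0] at e
  rw [e]
  set t := time q with ht
  have h1 := D.kahlerForm_sum hI hq (v := leftBracket (D.fr 0) (D.fr (i + 1).succ))
    (D.leftBracket_one_vec hJ hq.2 (i + 1)) (leftField (D.fr (i + 2).succ) q)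
  have h2 : D.kahlerForm I q
      ![leftField (leftBracket (D.fr (i + 1).succ) (D.fr (i + 2).succ)) q, leftField (D.fr 0) q] =
        D.ratio i t * (D.vol t ^ 2 * D.dir I i t) := by
    have hb := D.leftBracket_vec_vec hq.2 (i + 1)
    have a1 : i + 1 + 1 = i + 2 := (by decide : ∀ i : Fin 3, i + 1 + 1 = i + 2) i
    have a2 : i + 1 + 2 = i := (by decide : ∀ i : Fin 3, i + 1 + 2 = i) i
    rw [a1, a2] at hb
    have h := D.kahlerForm_apply hI hq (leftField (D.fr i.succ) q) (leftField (D.fr 0) q)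
    rw [kahlerForm_swap, K0 q hq i] at h
    rw [D.kahlerForm_apply hI hq, leftField, fr_succ, fr_succ, hb, mul_smul_comm, map_smul,
      map_smul, smul_apply]
    rw [fr_succ, leftField] at h
    rw [← h, ratio, smul_eq_mul]
    ring
  have h3 := D.kahlerForm_sum hI hq (v := leftBracket (D.fr (i + 2).succ) (D.fr 0))
    (c := fun m => -D.struct (i + 2) m t) (by
      have := D.leftBracket_one_vec hJ hq.2 (i + 2)
      have hs : leftBracket (D.fr (i + 2).succ) (D.fr 0) (time q) =
          -leftBracket (fun _ => 1) (D.vec (i + 2)) (time q) := by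
        simp only [leftBracket, fr_zero, fr_succ]; abel
      rw [hs, this]
      simp [ht]) (leftField (D.fr (i + 1).succ) q)
  have hd : ∀ k, deriv (fun s => D.vol s ^ 2 * D.dir I k s) t =
      2 * D.vol t * deriv D.vol t * D.dir I k t + D.vol t ^ 2 * deriv (D.dir I k) t := by
    intro k
    have := ((hv.hasDerivAt.pow 2).mul (hx k).hasDerivAt).deriv
    refine Eq.trans this ?_
    simp [ht]
  have f := D.deriv_dir hJ hI hinv hor hq.2 i
  have hvol := D.deriv_vol hJ hq.2
  have k0 := K q hq 0
  have k1 := K q hq 1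
  have k2 := K q hq 2
  have s0 := D.struct_self hJ hq.2 0
  have s1 := D.struct_self hJ hq.2 1
  have s2 := D.struct_self hJ hq.2 2
  have c0 := D.struct_cyc 0 t
  have c1 := D.struct_cyc 1 t
  have c2 := D.struct_cyc 2 t
  have d0 := D.struct_cyc' 0 t
  have d1 := D.struct_cyc' 1 t
  have d2 := D.struct_cyc' 2 t
  have y0 := D.shape_symm 1 0 t
  have y1 := D.shape_symm 2 1 t
  have y2 := D.shape_symm 0 2 t
  have l0 := (D.kahlerForm_swap (I := I) q _ _).trans (congrArg _ k0)
  have l1 := (D.kahlerForm_swap (I := I) q _ _).trans (congrArg _ k1)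
  have l2 := (D.kahlerForm_swap (I := I) q _ _).trans (congrArg _ k2)
  rw [← ht] at s0 s1 s2 f hvol k0 k1 k2 l0 l1 l2
  simp only [Fin.reduceAdd] at s0 s1 s2 c0 c1 c2 d0 d1 d2 k0 k1 k2 l0 l1 l2
  simp only [Matrix.cons_val_zero, Matrix.cons_val_one, Matrix.cons_val, h1, h2, h3]
  simp only [Fin.sum_univ_three, Matrix.cons_val_zero, Matrix.cons_val_one, Matrix.cons_val,
    deriv.fun_neg, hd]
  have r0 : (D.fr 0 t).re = 1 := rfl
  have r1 : ∀ i : Fin 3, (D.fr i.succ t).re = 0 := fun i => by rw [fr_succ, vec_re]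
  simp only [r0, r1, ← ht]
  clear h1 h2 h3 e hd K K0 hx
  -- After the structure functions are expanded, what remains is to insert `x'` from `deriv_dir` and
  -- `vol'` from `deriv_vol`; the `rot` and `ratio` terms cancel.
  fin_cases i <;>
    simp only [Fin.reduceAdd, Fin.zero_eta, Fin.mk_one, Fin.reduceFinMk, zero_add,
      kahlerForm_self, k0, k1, k2, l0, l1, l2, c0, c1, c2, d0, d1, d2, s0, s1, s2, shapeTrace,
      shapeDir, Fin.sum_univ_three, shape_self, y0, y1, y2] at f hvol ⊢
  · linear_combination -D.vol t ^ 2 * f - D.vol t * D.dir I 0 t * hvol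
  · linear_combination -D.vol t ^ 2 * f - D.vol t * D.dir I 1 t * hvol
  · linear_combination -D.vol t ^ 2 * f - D.vol t * D.dir I 2 t * hvol

end InvariantMetric

/-- Three distinct indices either contain `0` or are `1, 2, 3`, so four triples determine a 3-form
in dimension four. -/
theorem exists_perm_triple : ∀ a b c : Fin 4, a ≠ b → b ≠ c → a ≠ c →
    ∃ σ : Equiv.Perm (Fin 3), (∃ i : Fin 3, ![a, b, c] ∘ σ = ![0, (i + 1).succ, (i + 2).succ]) ∨
      ![a, b, c] ∘ σ = Fin.succ := by decide

theorem alternating_eq_zero {E : Type*} [AddCommGroup E] [Module ℝ E]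
    (b : Module.Basis (Fin 4) ℝ E) (f : E [⋀^Fin 3]→ₗ[ℝ] ℝ)
    (h0 : ∀ i : Fin 3, f ![b 0, b (i + 1).succ, b (i + 2).succ] = 0)
    (h1 : f (fun i => b i.succ) = 0) : f = 0 := by
  refine Module.Basis.ext_alternating b fun v hv => ?_
  obtain ⟨σ, h⟩ := exists_perm_triple (v 0) (v 1) (v 2) (hv.ne (by decide)) (hv.ne (by decide))
    (hv.ne (by decide))
  have e : ![v 0, v 1, v 2] = v := by funext k; fin_cases k <;> rfl
  rw [e] at h
  have hp : f ((fun i => b (v i)) ∘ σ) = 0 := by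
    have : (fun i => b (v i)) ∘ σ = b ∘ (v ∘ σ) := rfl
    rw [this]
    rcases h with ⟨i, h⟩ | h
    · rw [h, ← h0 i]
      congr 1
      funext k; fin_cases k <;> rfl
    · rw [h, ← h1]; rfl
  rw [f.map_perm] at hp
  have := (smul_eq_zero_iff_eq _).1 hp
  simpa using this

namespace InvariantMetric

variable {J : Set ℝ} (D : InvariantMetric J) {I : ℍ → ℍ →L[ℝ] ℍ}

theorem exists_basis_fr {q : ℍ} (hq : q ∈ cylinder J) :
    ∃ b : Module.Basis (Fin 4) ℝ ℍ, ∀ i, b i = leftField (D.fr i) q := by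
  refine ⟨basisOfTopLeSpanOfCardEqFinrank (fun i => leftField (D.fr i) q) ?_ ?_, ?_⟩
  · intro v _
    rw [D.eq_sum_fr hq v]
    exact Submodule.smul_mem _ _ (Submodule.sum_mem _ fun i _ =>
      Submodule.smul_mem _ _ (Submodule.subset_span (Set.mem_range_self i)))
  · simp [Quaternion.finrank_eq_four]
  · simp

theorem closed_iff (hJ : IsOpen J) (hI : D.IsHermitian I) (hinv : IsInvariant J I)
    (hor : D.IsOriented I) : (∀ q ∈ cylinder J, extDeriv (D.kahlerForm I) q = 0) ↔
      ∀ t ∈ J, ∀ i, 2 * D.shapeDir I i t =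
        (D.shapeTrace t + D.shapeQuad I t) * D.dir I i t := by
  constructor
  · intro h t ht i
    have e := D.extDeriv_kahlerForm_one hJ hI hinv hor (coe_exp_mem ht) i
    rw [h _ (coe_exp_mem ht), time_coe_exp] at e
    have hv := D.vol_pos ht
    have : D.vol t ^ 2 ≠ 0 := by positivity
    have := (mul_eq_zero.1 e.symm).resolve_left this
    linarith
  · intro h q hq
    obtain ⟨b, hb⟩ := D.exists_basis_fr hq
    apply ContinuousAlternatingMap.toAlternatingMap_injective
    refine alternating_eq_zero b _ (fun i => ?_) ?_
    · rw [hb, hb, hb]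
      refine (D.extDeriv_kahlerForm_one hJ hI hinv hor hq i).trans ?_
      rw [h _ hq.2 i]
      ring
    · simp only [hb]
      exact D.extDeriv_kahlerForm_vec hJ hI hinv hor hq

end InvariantMetric

/-! ### Linear algebra of the shape matrix -/

/-- If a symmetric matrix `S` has the form `f (1 - x xᵀ) + x zᵀ + z xᵀ - ζ x xᵀ` with `x` a unit
vector, `z = S x`, `ζ = x ⬝ z`, and its second and third elementary symmetric invariants vanish,
then `f = 0` and `S x = ζ x`. -/
theorem eigenvector_of_invariants_eq_zero {S : Fin 3 → Fin 3 → ℝ} {x z : Fin 3 → ℝ} {ζ f : ℝ}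
    (hS : ∀ i j, S i j = S j i) (hx : ∑ i, x i ^ 2 = 1) (hz : ∀ i, z i = ∑ j, S i j * x j)
    (hζ : ζ = ∑ i, x i * z i) (htr : S 0 0 + S 1 1 + S 2 2 = 2 * f + ζ)
    (hF : ∀ i j, S i j = f * ((if i = j then 1 else 0) - x i * x j) + x i * z j + z i * x j
      - ζ * x i * x j)
    (h2 : S 0 0 * S 1 1 + S 1 1 * S 2 2 + S 2 2 * S 0 0
      - S 0 1 ^ 2 - S 1 2 ^ 2 - S 2 0 ^ 2 = 0)
    (h3 : S 0 0 * S 1 1 * S 2 2 + 2 * S 0 1 * S 1 2 * S 2 0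
      - S 0 0 * S 1 2 ^ 2 - S 1 1 * S 2 0 ^ 2 - S 2 2 * S 0 1 ^ 2 = 0) :
    f = 0 ∧ ∀ i, z i = ζ * x i := by
  have F := fun i j => hF i j
  simp only [Fin.sum_univ_three] at hx hz hζ
  have y0 := hS 1 0
  have y1 := hS 2 1
  have y2 := hS 0 2
  have z0 := hz 0
  have z1 := hz 1
  have z2 := hz 2
  have F00 := F 0 0
  have F11 := F 1 1
  have F22 := F 2 2
  have F01 := F 0 1
  have F12 := F 1 2
  have F20 := F 2 0
  simp only [y0, y1, y2] at z0 z1 z2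
  rw [if_pos rfl] at F00 F11 F22
  rw [if_neg (by decide)] at F01 F12 F20
  clear F hF hz hS y0 y1 y2
  generalize S 0 0 = a at *
  generalize S 1 1 = b at *
  generalize S 2 2 = c at *
  generalize S 0 1 = p at *
  generalize S 1 2 = q at *
  generalize S 2 0 = r at *
  have hi : (z 0 = ζ * x 0 ∧ z 1 = ζ * x 1 ∧ z 2 = ζ * x 2) → ∀ i, z i = ζ * x i := by
    rintro ⟨h0, h1, h2⟩ i
    fin_cases i
    exacts [h0, h1, h2]
  refine (fun h => ⟨h.1, hi h.2⟩ : (f = 0 ∧ _) → _) ?_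
  clear hi
  generalize x 0 = x0 at *
  generalize x 1 = x1 at *
  generalize x 2 = x2 at *
  generalize z 0 = z0' at *
  generalize z 1 = z1' at *
  generalize z 2 = z2' at *
  set P := z0' ^ 2 + z1' ^ 2 + z2' ^ 2 with hP
  -- In a basis adapted to `x`, with `y = z - ζx` orthogonal to `x`, the blocks of `S` are `ζ`, `y`
  -- and `f` times the identity, and `|y|² = P - ζ²`. This is `tr S²`.
  have hsq : a ^ 2 + b ^ 2 + c ^ 2 + 2 * p ^ 2 + 2 * q ^ 2 + 2 * r ^ 2 =
      2 * f ^ 2 + 2 * P - ζ ^ 2 := by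
    have e : a ^ 2 + b ^ 2 + c ^ 2 + 2 * p ^ 2 + 2 * q ^ 2 + 2 * r ^ 2 =
        f * (a + b + c - (x0 * z0' + x1 * z1' + x2 * z2')) + 2 * P
          - ζ * (x0 * z0' + x1 * z1' + x2 * z2') := by
      rw [hP]
      have e0 : x0 * z0' + x1 * z1' + x2 * z2' = a * x0 ^ 2 + b * x1 ^ 2 + c * x2 ^ 2
          + 2 * p * x0 * x1 + 2 * q * x1 * x2 + 2 * r * x2 * x0 := by
        rw [z0, z1, z2]; ring
      have e1 : z0' ^ 2 + z1' ^ 2 + z2' ^ 2 = a * x0 * z0' + b * x1 * z1' + c * x2 * z2'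
          + p * (x0 * z1' + x1 * z0') + q * (x1 * z2' + x2 * z1') + r * (x2 * z0' + x0 * z2') := by
        linear_combination z0' * z0 + z1' * z1 + z2' * z2
      rw [e0, e1]
      linear_combination a * F00 + b * F11 + c * F22 + 2 * p * F01 + 2 * q * F12 + 2 * r * F20
    rw [e, htr, ← hζ]; ring
  -- The second invariant, as `((tr S)² - tr S²)/2`.
  have e2 : f ^ 2 + 2 * f * ζ - (P - ζ ^ 2) = 0 := by
    have : (a + b + c) ^ 2 = (2 * f + ζ) ^ 2 := by rw [htr]
    linear_combination (2 * h2 + hsq - this) / 2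
  have hzz : z0' * (a * z0' + p * z1' + r * z2') + z1' * (p * z0' + b * z1' + q * z2')
      + z2' * (r * z0' + q * z1' + c * z2') = f * (P - ζ ^ 2) + 2 * P * ζ - ζ ^ 3 := by
    have e : z0' * (a * z0' + p * z1' + r * z2') + z1' * (p * z0' + b * z1' + q * z2')
      + z2' * (r * z0' + q * z1' + c * z2') = f * (P - (x0 * z0' + x1 * z1' + x2 * z2') ^ 2)
        + 2 * P * (x0 * z0' + x1 * z1' + x2 * z2')
        - ζ * (x0 * z0' + x1 * z1' + x2 * z2') ^ 2 := by
      rw [hP]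
      linear_combination z0' ^ 2 * F00 + z1' ^ 2 * F11 + z2' ^ 2 * F22 + 2 * z0' * z1' * F01
        + 2 * z1' * z2' * F12 + 2 * z2' * z0' * F20
    rw [e, ← hζ]; ring
  -- The Cayley–Hamilton identity for `S`, paired with `x` on both sides.
  have hch : z0' * (a * z0' + p * z1' + r * z2') + z1' * (p * z0' + b * z1' + q * z2')
      + z2' * (r * z0' + q * z1' + c * z2') - (a + b + c) * P
      + (a * b + b * c + c * a - p ^ 2 - q ^ 2 - r ^ 2) * (x0 * z0' + x1 * z1' + x2 * z2') =
      (a * b * c + 2 * p * q * r - a * q ^ 2 - b * r ^ 2 - c * p ^ 2) *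
        (x0 ^ 2 + x1 ^ 2 + x2 ^ 2) := by
    rw [hP, z0, z1, z2]; ring
  rw [hzz, htr, h2, h3] at hch
  -- The third invariant is `f²ζ - f|y|²`; eliminating `|y|²` with `e2` leaves this.
  have hf : f ^ 2 * (f + ζ) = 0 := by linear_combination -hch - (ζ - f) * e2
  have e : (z0' - ζ * x0) ^ 2 + (z1' - ζ * x1) ^ 2 + (z2' - ζ * x2) ^ 2 = P - ζ ^ 2 := by
    rw [hP]; linear_combination ζ ^ 2 * hx + 2 * ζ * hζ
  have hpos : 0 ≤ P - ζ ^ 2 := by rw [← e]; positivity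
  have f0 : f = 0 := by
    refine pow_eq_zero_iff (two_ne_zero) |>.1 ?_
    rcases mul_eq_zero.1 hf with h | h
    · exact h
    · refine le_antisymm ?_ (sq_nonneg f)
      -- If `ζ = -f`, then `e2` gives `f² = -|y|²`.
      have : f ^ 2 = -(P - ζ ^ 2) := by linear_combination -e2 + 2 * f * h
      linarith only [this, hpos]
  have h0 : P - ζ ^ 2 = 0 := by rw [f0] at e2; linear_combination -e2
  rw [h0] at e
  have g0 := sq_nonneg (z0' - ζ * x0)
  have g1 := sq_nonneg (z1' - ζ * x1)
  have g2 := sq_nonneg (z2' - ζ * x2)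
  refine ⟨f0, ?_, ?_, ?_⟩ <;> refine sub_eq_zero.1 (pow_eq_zero_iff two_ne_zero |>.1 ?_) <;>
    linarith only [e, g0, g1, g2]

/-! ### The Kähler criteria in terms of the shape matrix -/

namespace InvariantMetric

variable {J : Set ℝ} (D : InvariantMetric J) {I : ℍ → ℍ →L[ℝ] ℍ}

theorem shape_cyc (hJ : IsOpen J) {t : ℝ} (ht : t ∈ J) (i : Fin 3) :
    D.shape i (i + 1) t = -D.X (i + 2) t / 2 := by
  have h : ∀ i : Fin 3, i ≠ i + 1 := by decide
  have h1 : i + 2 + 1 = i := by revert i; decide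
  have h2 : i + 2 + 2 = i + 1 := by revert i; decide
  have hx : D.xi (i + 2) t = D.spin i (i + 1) t := by rw [xi, spin, h1, h2]
  have w1 := (D.w_pos ht i).ne'
  have w2 := (D.w_pos ht (i + 1)).ne'
  rw [shape, if_neg (h i), X, h1, h2, hx, struct, struct, if_neg (h i), if_neg (h i).symm,
    D.spin_skew hJ ht (i + 1) i]
  field_simp
  ring

/-- Both `rot` and the off-diagonal entry of `shape` are multiples of the same spin component, with
factors proportional to `wᵢ² + wⱼ²` and `-(wᵢ² - wⱼ²)`. The product form remains valid when `wᵢ =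
wⱼ`. -/
theorem rot_mul_sub (hJ : IsOpen J) {t : ℝ} (ht : t ∈ J) (i : Fin 3) :
    D.rot (i + 2) t * (D.w i t ^ 2 - D.w (i + 1) t ^ 2) =
      -(D.shape i (i + 1) t * (D.w i t ^ 2 + D.w (i + 1) t ^ 2)) := by
  have h : ∀ i : Fin 3, i ≠ i + 1 := by decide
  have h1 : i + 2 + 1 = i := by revert i; decide
  have h2 : i + 2 + 2 = i + 1 := by revert i; decide
  have w1 := (D.w_pos ht i).ne'
  have w2 := (D.w_pos ht (i + 1)).ne'
  rw [shape, if_neg (h i), rot, h1, h2, struct, struct, if_neg (h i), if_neg (h i).symm,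
    D.spin_skew hJ ht (i + 1) i]
  field_simp
  ring

/-- The second elementary symmetric function of the shape matrix. -/
def shapeMinors (t : ℝ) : ℝ :=
  D.shape 0 0 t * D.shape 1 1 t + D.shape 1 1 t * D.shape 2 2 t + D.shape 2 2 t * D.shape 0 0 t
    - D.shape 0 1 t ^ 2 - D.shape 1 2 t ^ 2 - D.shape 2 0 t ^ 2

/-- With `S' = e₂ - 2 adj S + [K, S]`, the commutator does not affect `e₂`, and `e₂' = tr((T - S)S')
= 2T e₂ - 2(T e₂ - 3 det S) = 6 det S`. -/
theorem deriv_shapeMinors (hJ : IsOpen J) (hD : D.IsASDScalarFlat) {t : ℝ} (ht : t ∈ J) :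
    deriv D.shapeMinors t = 6 * (D.shape 0 0 t * D.shape 1 1 t * D.shape 2 2 t
      + 2 * D.shape 0 1 t * D.shape 1 2 t * D.shape 2 0 t - D.shape 0 0 t * D.shape 1 2 t ^ 2
      - D.shape 1 1 t * D.shape 2 0 t ^ 2 - D.shape 2 2 t * D.shape 0 1 t ^ 2) := by
  have d := fun r s => (D.differentiableAt_shape hJ ht r s).hasDerivAt
  have h := ((((((d 0 0).mul (d 1 1)).add ((d 1 1).mul (d 2 2))).add ((d 2 2).mul (d 0 0))).sub
    ((d 0 1).pow 2)).sub ((d 1 2).pow 2)).sub ((d 2 0).pow 2)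
  refine Eq.trans h.deriv ?_
  rw [D.deriv_shape hJ hD ht 0 0, D.deriv_shape hJ hD ht 1 1, D.deriv_shape hJ hD ht 2 2,
    D.deriv_shape hJ hD ht 0 1, D.deriv_shape hJ hD ht 1 2, D.deriv_shape hJ hD ht 2 0]
  have s0 := D.struct_self hJ ht 0
  have s1 := D.struct_self hJ ht 1
  have s2 := D.struct_self hJ ht 2
  have c0 := D.struct_cyc 0 t
  have c1 := D.struct_cyc 1 t
  have c2 := D.struct_cyc 2 t
  have d0 := D.struct_cyc' 0 t
  have d1 := D.struct_cyc' 1 t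
  have d2 := D.struct_cyc' 2 t
  have y0 := D.shape_symm 1 0 t
  have y1 := D.shape_symm 2 1 t
  have y2 := D.shape_symm 0 2 t
  simp only [Fin.reduceAdd, Fin.sum_univ_three, zero_add, ← shape_self] at *
  simp only [s0, s1, s2, c0, c1, c2, d0, d1, d2, y0, y1, y2]
  push_cast
  ring

theorem shape_eq_of_closed (hJ : IsOpen J) (hI : D.IsHermitian I) (hinv : IsInvariant J I)
    (hor : D.IsOriented I) {t : ℝ} (ht : t ∈ J)
    (h : ∀ i, 2 * D.shapeDir I i t = (D.shapeTrace t + D.shapeQuad I t) * D.dir I i t) :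
    (∀ i j, D.shape i j t = D.shapeQuad I t * D.dir I i t * D.dir I j t) ∧
      ∀ i, D.shapeDir I i t = D.shapeQuad I t * D.dir I i t := by
  have hx := D.sum_dir_sq hI hinv ht
  have hq : D.shapeQuad I t = ∑ i, D.dir I i t * D.shapeDir I i t := rfl
  rw [Fin.sum_univ_three] at hx hq
  have hT : D.shapeTrace t = D.shapeQuad I t := by
    -- Pair the closedness equation with `x`: `2ζ = T + ζ`.
    linear_combination -2 * hq - D.dir I 0 t * h 0 - D.dir I 1 t * h 1 - D.dir I 2 t * h 2
      - (D.shapeTrace t + D.shapeQuad I t) * hx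
  have hz : ∀ i, D.shapeDir I i t = D.shapeQuad I t * D.dir I i t := fun i => by
    have := h i
    rw [hT] at this
    linear_combination this / 2
  refine ⟨fun i j => ?_, hz⟩
  have := D.shape_eq hJ hI hinv hor ht i j
  rw [hT, hz, hz] at this
  linear_combination this / 2

theorem X_eq (hJ : IsOpen J) {t : ℝ} (ht : t ∈ J) :
    D.X 0 t = -2 * D.shape 1 2 t ∧ D.X 1 t = -2 * D.shape 2 0 t ∧
      D.X 2 t = -2 * D.shape 0 1 t := by
  have h0 := D.shape_cyc hJ ht 0
  have h1 := D.shape_cyc hJ ht 1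
  have h2 := D.shape_cyc hJ ht 2
  simp only [Fin.reduceAdd, zero_add] at h0 h1 h2
  refine ⟨?_, ?_, ?_⟩ <;> linarith

/-- The sum of the three equations already says that `e₂` vanishes; since it vanishes on the open
set `J`, so does its derivative `6 det S`. -/
theorem closed_of_X_sq (hJ : IsOpen J) (hD : D.IsASDScalarFlat) (hI : D.IsHermitian I)
    (hinv : IsInvariant J I) (hor : D.IsOriented I)
    (h : ∀ t ∈ J, D.X 0 t ^ 2 = 4 * D.alpha 1 t * D.alpha 2 t ∧
      D.X 1 t ^ 2 = 4 * D.alpha 2 t * D.alpha 0 t ∧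
      D.X 2 t ^ 2 = 4 * D.alpha 0 t * D.alpha 1 t) {t : ℝ} (ht : t ∈ J) (i : Fin 3) :
    2 * D.shapeDir I i t = (D.shapeTrace t + D.shapeQuad I t) * D.dir I i t := by
  have e2 : ∀ s ∈ J, D.shapeMinors s = 0 := fun s hs => by
    obtain ⟨h0, h1, h2⟩ := h s hs
    obtain ⟨x0, x1, x2⟩ := D.X_eq hJ hs
    rw [x0] at h0
    rw [x1] at h1
    rw [x2] at h2
    rw [shapeMinors, shape_self, shape_self, shape_self]
    linear_combination -(h0 + h1 + h2) / 4
  have e3 := D.deriv_shapeMinors hJ hD ht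
  have e : D.shapeMinors =ᶠ[nhds t] fun _ => 0 :=
    Filter.eventually_of_mem (hJ.mem_nhds ht) e2
  rw [e.deriv_eq, deriv_const] at e3
  have htr : D.shape 0 0 t + D.shape 1 1 t + D.shape 2 2 t = D.shapeTrace t := by
    rw [shapeTrace, Fin.sum_univ_three, shape_self, shape_self, shape_self]
  obtain ⟨f0, hz⟩ := eigenvector_of_invariants_eq_zero (S := fun i j => D.shape i j t)
    (x := fun i => D.dir I i t) (z := fun i => D.shapeDir I i t) (ζ := D.shapeQuad I t)
    (f := (D.shapeTrace t - D.shapeQuad I t) / 2) (fun i j => D.shape_symm i j t)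
    (D.sum_dir_sq hI hinv ht) (fun i => rfl) rfl (by rw [htr]; ring)
    (fun i j => by linear_combination D.shape_eq hJ hI hinv hor ht i j / 2)
    (e2 t ht) (by linear_combination -e3 / 6)
  rw [hz i]
  linear_combination -2 * D.dir I i t * f0

theorem X_sq_of_closed (hJ : IsOpen J) (hI : D.IsHermitian I) (hinv : IsInvariant J I)
    (hor : D.IsOriented I) {t : ℝ} (ht : t ∈ J)
    (h : ∀ i, 2 * D.shapeDir I i t = (D.shapeTrace t + D.shapeQuad I t) * D.dir I i t) :
    D.X 0 t ^ 2 = 4 * D.alpha 1 t * D.alpha 2 t ∧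
      D.X 1 t ^ 2 = 4 * D.alpha 2 t * D.alpha 0 t ∧
      D.X 2 t ^ 2 = 4 * D.alpha 0 t * D.alpha 1 t := by
  obtain ⟨hS, -⟩ := D.shape_eq_of_closed hJ hI hinv hor ht h
  obtain ⟨x0, x1, x2⟩ := D.X_eq hJ ht
  rw [x0, x1, x2, ← shape_self, ← shape_self, ← shape_self]
  simp only [hS]
  refine ⟨?_, ?_, ?_⟩ <;> ring

theorem dir_sq_eq_of_closed (hJ : IsOpen J) (hI : D.IsHermitian I) (hinv : IsInvariant J I)
    (hor : D.IsOriented I) {t φ : ℝ} (ht : t ∈ J)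
    (h : ∀ i, 2 * D.shapeDir I i t = (D.shapeTrace t + D.shapeQuad I t) * D.dir I i t)
    (hφ : D.X 0 t ^ 2 = 4 * (φ - D.alpha 1 t) * (φ - D.alpha 2 t) ∧
      D.X 1 t ^ 2 = 4 * (φ - D.alpha 2 t) * (φ - D.alpha 0 t) ∧
      D.X 2 t ^ 2 = 4 * (φ - D.alpha 0 t) * (φ - D.alpha 1 t)) (h0 : φ ≠ 0) :
    D.shapeQuad I t ≠ 0 ∧ ∀ i, D.dir I i t ^ 2 = 1 / 3 := by
  obtain ⟨hS, -⟩ := D.shape_eq_of_closed hJ hI hinv hor ht h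
  obtain ⟨x0, x1, x2⟩ := D.X_eq hJ ht
  rw [x0, x1, x2, ← shape_self, ← shape_self, ← shape_self] at hφ
  simp only [hS] at hφ
  obtain ⟨p0, p1, p2⟩ := hφ
  have hx := D.sum_dir_sq hI hinv ht
  rw [Fin.sum_univ_three] at hx
  -- As `S = ζxxᵀ`, the hypothesis reads `(φ - αⱼ)(φ - αₖ) = αⱼαₖ`, so `φ = αⱼ + αₖ = ζ(xⱼ² + xₖ²)`
  -- for each pair; equality of these three sums equalizes the `xᵢ²`.
  have q0 := mul_left_cancel₀ h0 (show φ * φ = φ * (D.shapeQuad I t *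
    (D.dir I 1 t ^ 2 + D.dir I 2 t ^ 2)) by linear_combination -p0 / 4)
  have q1 := mul_left_cancel₀ h0 (show φ * φ = φ * (D.shapeQuad I t *
    (D.dir I 2 t ^ 2 + D.dir I 0 t ^ 2)) by linear_combination -p1 / 4)
  have q2 := mul_left_cancel₀ h0 (show φ * φ = φ * (D.shapeQuad I t *
    (D.dir I 0 t ^ 2 + D.dir I 1 t ^ 2)) by linear_combination -p2 / 4)
  have hl : D.shapeQuad I t ≠ 0 := fun hl => h0 (by rw [q0, hl, zero_mul])
  have r0 : D.dir I 0 t ^ 2 = D.dir I 1 t ^ 2 :=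
    mul_left_cancel₀ hl (by linear_combination q0 - q1)
  have r1 : D.dir I 1 t ^ 2 = D.dir I 2 t ^ 2 :=
    mul_left_cancel₀ hl (by linear_combination q1 - q2)
  refine ⟨hl, fun i => ?_⟩
  fin_cases i <;> simp only [Fin.zero_eta, Fin.mk_one, Fin.reduceFinMk] <;>
    linarith only [hx, r0, r1]

theorem eq_zero_of_closed (hJ : IsOpen J) (hI : D.IsHermitian I) (hinv : IsInvariant J I)
    (hor : D.IsOriented I)
    (h : ∀ t ∈ J, ∀ i, 2 * D.shapeDir I i t =
      (D.shapeTrace t + D.shapeQuad I t) * D.dir I i t) {φ : ℝ → ℝ} (hc : ContinuousOn φ J)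
    (hφ : ∀ t ∈ J, D.X 0 t ^ 2 = 4 * (φ t - D.alpha 1 t) * (φ t - D.alpha 2 t) ∧
      D.X 1 t ^ 2 = 4 * (φ t - D.alpha 2 t) * (φ t - D.alpha 0 t) ∧
      D.X 2 t ^ 2 = 4 * (φ t - D.alpha 0 t) * (φ t - D.alpha 1 t)) {t : ℝ} (ht : t ∈ J) :
    φ t = 0 := by
  -- Continuity of `φ` keeps it nonzero near `t`, so `xᵢ² = 1/3` holds on a neighbourhood and can be
  -- differentiated.
  by_contra h0
  have hev : ∀ᶠ s in nhds t, s ∈ J ∧ φ s ≠ 0 :=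
    Filter.Eventually.and (hJ.mem_nhds ht)
      ((hc.continuousAt (hJ.mem_nhds ht)).eventually_ne h0)
  obtain ⟨hl, hx⟩ := D.dir_sq_eq_of_closed hJ hI hinv hor ht (h t ht) (hφ t ht) h0
  obtain ⟨hS, hz⟩ := D.shape_eq_of_closed hJ hI hinv hor ht (h t ht)
  have hx0 : ∀ i, D.dir I i t ≠ 0 := fun i hi => by
    have := hx i
    rw [hi] at this
    norm_num at this
  have hd : ∀ i, deriv (D.dir I i) t = 0 := fun i => by
    have h1 := ((D.differentiableAt_dir hJ hI ht i).hasDerivAt.pow 2).deriv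
    have h2 : (D.dir I i ^ 2) =ᶠ[nhds t] fun _ => 1 / 3 := hev.mono fun s hs =>
      (D.dir_sq_eq_of_closed hJ hI hinv hor hs.1 (h s hs.1) (hφ s hs.1) hs.2).2 i
    rw [h2.deriv_eq, deriv_const] at h1
    have := hx0 i
    simpa [this] using h1.symm
  -- With `x' = 0` and `Sx = ζx`, `deriv_dir` reduces to `x × rot = 0`.
  have hr : ∀ i, D.rot (i + 2) t * D.dir I (i + 1) t = D.rot (i + 1) t * D.dir I (i + 2) t :=
    fun i => by
      have := D.deriv_dir hJ hI hinv hor ht i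
      rw [hd, hz] at this
      linear_combination -this
  have r0 := hr 0
  have r1 := hr 1
  have m0 := D.rot_mul_sub hJ ht 0
  have m1 := D.rot_mul_sub hJ ht 1
  have m2 := D.rot_mul_sub hJ ht 2
  have g0 := hx 0
  have g1 := hx 1
  have g2 := hx 2
  simp only [Fin.reduceAdd, zero_add, hS] at r0 r1 m0 m1 m2
  -- Since `3xᵢ² = 1`, parallelism of `rot` and `x` makes the three products `rotᵢ xᵢ` equal.
  have k0 : D.rot 2 t * D.dir I 2 t = D.rot 1 t * D.dir I 1 t := by
    linear_combination 3 * D.dir I 1 t * D.dir I 2 t * r0 - 3 * D.rot 2 t * D.dir I 2 t * g1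
      + 3 * D.rot 1 t * D.dir I 1 t * g2
  have k1 : D.rot 0 t * D.dir I 0 t = D.rot 2 t * D.dir I 2 t := by
    linear_combination 3 * D.dir I 2 t * D.dir I 0 t * r1 - 3 * D.rot 0 t * D.dir I 0 t * g2
      + 3 * D.rot 2 t * D.dir I 2 t * g0
  -- Multiply each relation of `rot_mul_sub` by the remaining component of `x` and add: the
  -- differences `wᵢ² - wⱼ²` have the common factor `rotᵢ xᵢ` and cancel cyclically, while the sums
  -- `wᵢ² + wⱼ²` add up.
  have hsum : D.shapeQuad I t * (D.dir I 0 t * D.dir I 1 t * D.dir I 2 t) *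
      (D.w 0 t ^ 2 + D.w 1 t ^ 2 + D.w 2 t ^ 2) = 0 := by
    linear_combination (D.dir I 2 t * m0 + D.dir I 0 t * m1 + D.dir I 1 t * m2) / 2
      - (D.w 1 t ^ 2 - D.w 2 t ^ 2) / 2 * k1 + (D.w 2 t ^ 2 - D.w 0 t ^ 2) / 2 * k0
  have w0 := D.w_pos ht 0
  have w1 := D.w_pos ht 1
  have w2 := D.w_pos ht 2
  have hw : D.w 0 t ^ 2 + D.w 1 t ^ 2 + D.w 2 t ^ 2 ≠ 0 := by positivity
  exact mul_ne_zero (mul_ne_zero hl (mul_ne_zero (mul_ne_zero (hx0 0) (hx0 1)) (hx0 2))) hw hsum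

end InvariantMetric

end SU2Metric

end

theorem theorem4p3 (J : Set ℝ) (hJ : IsOpen J) (D : SU2Metric.InvariantMetric J)
    (hD : D.IsASDScalarFlat) (I : ℍ → ℍ →L[ℝ] ℍ) (hI : D.IsHermitian I)
    (hinv : SU2Metric.IsInvariant J I) (hor : D.IsOriented I) :
    (D.IsKahler I ↔ ∀ t ∈ J,
      D.X 0 t ^ 2 = 4 * D.alpha 1 t * D.alpha 2 t ∧
      D.X 1 t ^ 2 = 4 * D.alpha 2 t * D.alpha 0 t ∧
      D.X 2 t ^ 2 = 4 * D.alpha 0 t * D.alpha 1 t) ∧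
    ∀ f : ℝ → ℝ, ContinuousOn f J →
      (∀ t ∈ J,
        D.X 0 t ^ 2 = 4 * (f t - D.alpha 1 t) * (f t - D.alpha 2 t) ∧
        D.X 1 t ^ 2 = 4 * (f t - D.alpha 2 t) * (f t - D.alpha 0 t) ∧
        D.X 2 t ^ 2 = 4 * (f t - D.alpha 0 t) * (f t - D.alpha 1 t)) →
      (D.IsKahler I ↔ ∀ t ∈ J, f t = 0) := by
  have hK : D.IsKahler I ↔ ∀ t ∈ J, ∀ i, 2 * D.shapeDir I i t =
      (D.shapeTrace t + D.shapeQuad I t) * D.dir I i t :=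
    (and_iff_right hI).trans (D.closed_iff hJ hI hinv hor)
  rw [hK]
  have h1 := D.closed_of_X_sq hJ hD hI hinv hor
  refine ⟨⟨fun h t ht => D.X_sq_of_closed hJ hI hinv hor ht (h t ht),
    fun h t ht i => h1 h ht i⟩, fun f hc hf => ⟨fun h t ht =>
      D.eq_zero_of_closed hJ hI hinv hor h hc hf ht, fun h t ht i => h1 (fun s hs => ?_) ht i⟩⟩
  have := hf s hs
  rw [h s hs] at this
  obtain ⟨e0, e1, e2⟩ := this
  refine ⟨?_, ?_, ?_⟩
  · linear_combination e0
  · linear_combination e1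
  · linear_combination e2
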